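/- **Conventions.** A *class with order* $\mathfrak k=(K,\le)$ consists of a class $K$ of structures in a vocabulary $\tau$ and a partial order $\le$ on $K$ such that $M\le N$ implies $M\subseteq N$, both closed under isomorphism; a $\le$-embedding of $M$ into $N$ is an isomorphism of $M$ onto some $M_1\le N$. For cardinals $\lambda,\mu$ let $\mathrm{univ}(\lambda\to\mu,\mathfrak k)$ be the least number of members of $K$, each of cardinality $\le\mu$, such that every member of $K$ of cardinality $\lambda$ has a $\le$-embedding into one of them. "$\mathfrak k$ has no universal member in $\lambda$" means that there is no $M\in K$ with $\|M\|\le\lambda$ into which every member of $K$ of cardinality $\lambda$ has a $\le$-embedding. A complete first order theory $T$ is identified with its class of models ordered by $\prec$, and $|T|$ is the number of its symbols plus $\aleph_0$. A universal class is a class of structures closed under isomorphisms, substructures and unions of increasing chains; it is ordered by $\subseteq$. **Olive property.** Let $n,m\in\mathbb N$, $\eta\in{}^n\{0,1\}$ and $\bar k=(k_0,k_1)$ with $k_0,k_1\ge1$, $n\ge k_0+k_1\ge 3$, $\eta(0)=0$ and $\eta^{-1}\{0\}$ not an initial segment of $n$. Consider formulas $\psi_{\iota,r}(\bar x_0,\dots,\bar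 x_r)$ for $\iota\in\{0,1\}$, $1\le r\le k_\iota$, each $\bar x_i$ an $m$-tuple of variables. * $(b)_\lambda$ for $\bar f=\langle f_\beta:\beta<\lambda\rangle$, $f_\beta:\beta\to\{0,1\}$, in a structure $M$: there are $\bar a_\alpha\in{}^mM$ $(\alpha<\lambda)$ such that $M\models\psi_{\iota,r}[\bar a_{\alpha_0},\dots,\bar a_{\alpha_{r-1}},\bar a_\beta]$ whenever $1\le r\le k_\iota$, $\alpha_0<\dots<\alpha_{r-1}<\beta<\lambda$ and $f_\beta$ is constantly $\iota$ on $[\alpha_0,\alpha_{r-1}]$. * $(c)$ in $M$: there are no $\bar a_0,\dots,\bar a_n\in{}^mM$ such that $M\models\psi_{\iota,r}[\bar a_{\ell_0},\dots,\bar a_{\ell_{r-1}},\bar a_j]$ whenever $1\le r\le k_\iota$, $\ell_0<\dots<\ell_{r-1}<n$, $\eta(\ell_0)=\dots=\eta(\ell_{r-1})=\iota$ and $\ell_{r-1}<j\le n$. A complete first order $T$ has the $(\eta,\bar k,m)$-olive property if there are first order formulas $\psi_{\iota,r}$ such that for every infinite cardinal $\lambda$ and every $\bar f$, $(b)_\lambda$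 holds in some model of $T$, and $(c)$ holds in every model of $T$; it has the $(\eta,\bar k)$-olive property if this holds for some $m$. A class with order $\mathfrak k$ has the $\lambda$-$(\eta,\bar k,m)$-olive property if there are formulas $\psi_{\iota,r}$ of any logic (isomorphism invariant relations on the members of $K$), preserved by passing from $M$ to $N\ge M$, such that for every $\bar f$, $(b)_\lambda$ holds in some member of $K$ of cardinality $\lambda$, and $(c)$ holds in every member of $K$. A universal class $K$ has the $\lambda$-$(\mathrm{qf},\eta,\bar k,m)$-olive property if there are quantifier free first order $\psi_{\iota,r}$ such that for every $\bar f$, $(b)_\lambda$ holds in some member of $K$, and $(c)$ holds in every member of $K$. **The condition $\mathrm{Qr}$.** For an ideal $I$ on a set $S$ (always $S\notin I$), $\mathbf U_I(\chi)$ is the least cardinality of a family $\mathscr P$ of subsets of $\chi$, each of cardinality $\le|S|$, such that for every $f:S\to\chi$ there is $u\in\mathscr P$ with $\{a\in S:f(a)\in u\}\notin I$. For a set $C$ of ordinals, $\mathrm{nacc}(C)=\{\gamma\in C:\sup(C\cap\gamma)<\gamma\}$. For a cardinal $\theta$, $\mathrm{Qr}_{1,\theta}(\chi_2,\chi_1,\lambda)$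 means: $\lambda$ is regular uncountable, $\lambda\le\chi_1<\chi_2$, and there are $S\subseteq\lambda$, an ideal $I$ on $S$, sets $C_\delta\subseteq\delta$ $(\delta\in S)$, functions $g_{j,\delta}:C_\delta\to\theta$ and families $\mathscr A_{j,\delta}$ of subsets of $\mathrm{nacc}(C_\delta)$ $(j<\chi_2,\delta\in S)$ such that * if $\chi_1>\lambda$ then $\mathbf U_I(\chi_1)<\chi_2$; * if $j_1\ne j_2$, $\delta\in S$, $A_1\in\mathscr A_{j_1,\delta}$, $A_2\in\mathscr A_{j_2,\delta}$, then $g_{j_1,\delta}(\gamma)\ne g_{j_2,\delta}(\gamma)$ for some $\gamma\in A_1\cap A_2$; * for every $j<\chi_2$ and every club $E$ of $\lambda$ there is $Y\subseteq S$ with $Y\notin I$, and with $S\setminus Y\in I$ in case $\chi_1>\lambda$, such that $\mathrm{nacc}(C_\delta)\cap E\in\mathscr A_{j,\delta}$ for all $\delta\in Y$. $\mathrm{Qr}_1$ is $\mathrm{Qr}_{1,2}$. **Theorem.** Let $n,\eta,\bar k$ be as above. 1. If $T$ is complete with the $(\eta,\bar k)$-olive property, $\kappa,\lambda$ are regular,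 $\kappa^+<\lambda<2^\kappa$ and $\lambda\ge\kappa^{++}+|T|$, then $T$ has no universal model in $\lambda$ (for $\prec$). 2. If $T$ is complete with the $(\eta,\bar k,m)$-olive property, $\lambda=\mathrm{cf}(\lambda)\ge|T|$ and $\mathrm{Qr}_1(\chi_2,\chi_1,\lambda)$ holds, then $\mathrm{univ}(\lambda\to\chi_1,T)\ge\chi_2$; that is, fewer than $\chi_2$ models of $T$ of cardinality $\le\chi_1$ cannot jointly elementarily embed all models of $T$ of cardinality $\lambda$. 3. The same holds for an abstract elementary class $\mathfrak k$ with the $\lambda$-$(\eta,\bar k,m)$-olive property, $\lambda$ regular, and for a universal class $K$ with the $\lambda$-$(\mathrm{qf},\eta,\bar k,m)$-olive property, $\lambda$ regular and at least the number of symbols of the vocabulary: if $\kappa$ is regular and $\kappa^+<\lambda<2^\kappa$ there is no universal member in $\lambda$, and if $\mathrm{Qr}_1(\chi_2,\chi_1,\lambda)$ holds then $\mathrm{univ}(\lambda\to\chi_1,\cdot)\ge\chi_2$. 4. In the conclusions $\mathrm{univ}(\lambda\to\chi_1,\cdot)\ge\chi_2$ of parts 2 and 3, $\mathrm{Qr}_1(\chi_2,\chi_1,\lambda)$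 can be weakened to $\mathrm{Qr}_{1,\theta}(\chi_2,\chi_1,\lambda)$ when $\theta=2^\partial$, $\chi_1=\chi_1^\partial$ and $\partial<\lambda$. -/

import Mathlib

open Cardinal Set FirstOrder

universe u

namespace Olive

/-! ### Classes of structures -/

/-- A pair consisting of a class `K` of `L`-structures and a partial order `≤` on `K` such that
`M ≤ N` implies that `M` is a substructure of `N`, both closed under isomorphism.  As `M ≤ N`
only holds for substructures, the order is given as a predicate on the substructures `S` of a
structure `N`; antisymmetry is then automatic. -/
structure ModelClass (L : FirstOrder.Language.{u, u}) where
  /-- `M ∈ K`. -/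
  Mem : ∀ (M : Type u) [L.Structure M], Prop
  /-- `S ≤ N`. -/
  Le : ∀ {N : Type u} [L.Structure N], L.Substructure N → Prop
  mem_iso : ∀ {M N : Type u} [L.Structure M] [L.Structure N], (M ≃[L] N) → Mem M → Mem N
  le_iso : ∀ {M N : Type u} [L.Structure M] [L.Structure N] (e : M ≃[L] N)
    (S : L.Substructure M), Le S → Le (S.map e.toHom)
  mem_of_le : ∀ {N : Type u} [L.Structure N] (S : L.Substructure N), Le S → Mem S ∧ Mem N
  le_refl : ∀ {N : Type u} [L.Structure N], Mem N → Le (⊤ : L.Substructure N)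
  le_trans : ∀ {N : Type u} [L.Structure N] (S T : L.Substructure N), S ≤ T →
    Le (S.comap T.subtype.toHom) → Le T → Le S

variable {L : FirstOrder.Language.{u, u}}

/-- `f` is a `≤`-embedding: an isomorphism of `M` onto some `M₁ ≤ N`. -/
def ModelClass.IsStrong (K : ModelClass L) {M N : Type u} [L.Structure M] [L.Structure N]
    (f : M ↪[L] N) : Prop :=
  K.Le f.toHom.range

/-- The least number of members of `K`, each of cardinality at most `mu`, such that every member
of `K` of cardinality `lam` has a `≤`-embedding into one of them. -/
noncomputable def ModelClass.univ (K : ModelClass L) (lam mu : Cardinal.{u}) : Cardinal.{u} :=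
  sInf {c | ∃ (ι : Type u) (M : ι → Type u) (_ : ∀ i, L.Structure (M i)),
    #ι = c ∧ (∀ i, K.Mem (M i) ∧ #(M i) ≤ mu) ∧
    ∀ (N : Type u) [L.Structure N], K.Mem N → #N = lam → ∃ i, ∃ f : N ↪[L] M i, K.IsStrong f}

/-- A single member of `K` of cardinality at most `lam` into which all members of `K` of
cardinality `lam` have `≤`-embeddings. -/
def ModelClass.HasUniversal (K : ModelClass L) (lam : Cardinal.{u}) : Prop :=
  ∃ (M : Type u) (_ : L.Structure M), K.Mem M ∧ #M ≤ lam ∧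
    ∀ (N : Type u) [L.Structure N], K.Mem N → #N = lam → ∃ f : N ↪[L] M, K.IsStrong f

/-! ### Models of a first order theory with elementary submodels -/

lemma isElementary_of_comap {N : Type u} [L.Structure N] (S T : L.Substructure N) (h : S ≤ T)
    (h₁ : (S.comap T.subtype.toHom).IsElementary) (h₂ : T.IsElementary) : S.IsElementary := by
  intro n φ x
  let e : S ↪ₑ[L] (S.comap T.subtype.toHom : L.Substructure T) :=
    FirstOrder.Language.Equiv.toElementaryEmbedding
      { toFun := fun s => ⟨⟨s.1, h s.2⟩, s.2⟩
        invFun := fun s => ⟨s.1.1, s.2⟩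
        left_inv := fun _ => rfl
        right_inv := fun _ => rfl
        map_fun' := fun _ _ => rfl
        map_rel' := fun _ _ => Iff.rfl }
  rw [← e.map_formula φ x, ← h₁ φ (e ∘ x), ← h₂ φ _]
  rfl

lemma isElementary_map {M N : Type u} [L.Structure M] [L.Structure N] (e : M ≃[L] N)
    (S : L.Substructure M) (h : S.IsElementary) : (S.map e.toHom).IsElementary := by
  intro n φ x
  let g := (e.toEmbedding.substructureEquivMap S)
  have hx : x = g ∘ (g.symm ∘ x) := by
    funext i
    exact (g.apply_symm_apply (x i)).symm
  have h1 := g.toElementaryEmbedding.map_formula φ (g.symm ∘ x)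
  have h2 := e.toElementaryEmbedding.map_formula φ ((↑) ∘ (g.symm ∘ x))
  have h3 := h φ (g.symm ∘ x)
  rw [hx]
  exact (h2.trans h3).trans h1.symm

/-- The models of `T`, ordered by being an elementary submodel. -/
def elemClass (T : L.Theory) : ModelClass L where
  Mem M _ := Nonempty M ∧ M ⊨ T
  Le {N} _ S := (Nonempty N ∧ N ⊨ T) ∧ S.IsElementary
  mem_iso := by
    rintro M N _ _ e ⟨⟨x⟩, h⟩
    exact ⟨⟨e x⟩, (e.toElementaryEmbedding.theory_model_iff T).1 h⟩
  le_iso := by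
    rintro M N _ _ e S ⟨⟨⟨x⟩, h⟩, hS⟩
    exact ⟨⟨⟨e x⟩, (e.toElementaryEmbedding.theory_model_iff T).1 h⟩, isElementary_map e S hS⟩
  mem_of_le := by
    rintro N _ S ⟨⟨h0, h⟩, hS⟩
    refine ⟨⟨?_, ?_⟩, h0, h⟩
    · exact (inferInstance : Nonempty (⟨S, hS⟩ : L.ElementarySubstructure N))
    · exact (inferInstance : (⟨S, hS⟩ : L.ElementarySubstructure N) ⊨ T)
  le_refl := by
    intro N _ h
    exact ⟨h, fun _ _ _ => FirstOrder.Language.Substructure.realize_formula_top.symm⟩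
  le_trans := by
    intro N _ S T h h₁ h₂
    exact ⟨h₂.1, isElementary_of_comap S T h h₁.2 h₂.2⟩

/-! ### Abstract elementary classes and universal classes -/

/-- `K` is an abstract elementary class. -/
structure IsAEC (K : ModelClass L) : Prop where
  coherence : ∀ {N : Type u} [L.Structure N] (S T : L.Substructure N), S ≤ T →
    K.Le S → K.Le T → K.Le (S.comap T.subtype.toHom)
  /-- The union of a `≤`-increasing chain is in `K` and is `≥` every member of the chain. -/
  chain : ∀ {ι : Type u} [LinearOrder ι] [WellFoundedLT ι] [Nonempty ι]
    {N : Type u} [L.Structure N] (S : ι → L.Substructure N), Monotone S →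
    (∀ i, K.Mem (S i)) → (∀ i j, i ≤ j → K.Le ((S i).comap (S j).subtype.toHom)) →
    K.Mem (⨆ i, S i : L.Substructure N) ∧
      ∀ i, K.Le ((S i).comap (⨆ i, S i : L.Substructure N).subtype.toHom)
  /-- If all members of a chain are `≤ N` then so is the union. -/
  smooth : ∀ {ι : Type u} [LinearOrder ι] [WellFoundedLT ι] [Nonempty ι]
    {N : Type u} [L.Structure N] (S : ι → L.Substructure N), Monotone S →
    (∀ i, K.Le (S i)) → K.Le (⨆ i, S i)
  /-- The Löwenheim-Skolem-Tarski axiom. -/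
  lst : ∃ κ : Cardinal.{u}, ℵ₀ ≤ κ ∧ L.card ≤ κ ∧
    ∀ {N : Type u} [L.Structure N], K.Mem N → ∀ A : Set N,
      ∃ S : L.Substructure N, A ⊆ S ∧ K.Le S ∧ #S ≤ #A + κ

/-- A universal class: a class of structures closed under isomorphisms, substructures and unions
of increasing chains. -/
structure UniversalClass (L : FirstOrder.Language.{u, u}) where
  /-- Membership in the class. -/
  Mem : ∀ (M : Type u) [L.Structure M], Prop
  mem_iso : ∀ {M N : Type u} [L.Structure M] [L.Structure N], (M ≃[L] N) → Mem M → Mem N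
  mem_sub : ∀ {N : Type u} [L.Structure N] (S : L.Substructure N), Mem N → Mem S
  mem_chain : ∀ {ι : Type u} [LinearOrder ι] [WellFoundedLT ι] [Nonempty ι]
    {N : Type u} [L.Structure N] (S : ι → L.Substructure N), Monotone S →
    (∀ i, Mem (S i)) → Mem (⨆ i, S i : L.Substructure N)

/-- A universal class, ordered by being a substructure. -/
def UniversalClass.toModelClass (K : UniversalClass L) : ModelClass L where
  Mem M _ := K.Mem M
  Le {N} _ _ := K.Mem N
  mem_iso := K.mem_iso
  le_iso e _ h := K.mem_iso e h
  mem_of_le S h := ⟨K.mem_sub S h, h⟩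
  le_refl h := h
  le_trans _ _ _ _ h := h

/-! ### The olive property -/

/-- A formula `φ(x̄_[I])` of an arbitrary logic, given by its satisfaction relation
`M ⊨ φ[x]`. -/
def SemFormula (L : FirstOrder.Language.{u, u}) (I : Type) : Type (u + 1) :=
  ∀ (M : Type u) [L.Structure M], (I → M) → Prop

/-- The formula `φ` is preserved upward by `≤`-embeddings.  (Isomorphisms between members of `K`
are `≤`-embeddings, so this includes invariance under isomorphism.) -/
def UpwardPreserved (K : ModelClass L) {I : Type} (φ : SemFormula L I) : Prop :=
  ∀ {M N : Type u} [L.Structure M] [L.Structure N] (f : M ↪[L] N), K.IsStrong f →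
    ∀ x : I → M, φ M x → φ N (f ∘ x)

/-- A first order formula, in an arbitrary logic. -/
def ofFormula {I : Type} (φ : L.Formula I) : SemFormula L I :=
  fun _ _ x => φ.Realize x

/-- The assumptions on the parameters `n`, `η ∈ ⁿ2`, `k̄ = (k₀, k₁)`. -/
structure IsShape {n : ℕ} (η : Fin n → Fin 2) (k : Fin 2 → ℕ) : Prop where
  one_le : ∀ ι, 1 ≤ k ι
  three_le : 3 ≤ k 0 + k 1
  le_n : k 0 + k 1 ≤ n
  eta_zero : ∀ i : Fin n, i.val = 0 → η i = 0
  /-- `η⁻¹{0}` is not an initial segment. -/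
  not_initial : ∃ i j : Fin n, i < j ∧ η i = 1 ∧ η j = 0

/-- Sequences `ψ̄_ι = ⟨ψ_{ι,r}(x̄_0, …, x̄_r) : r = 1, …, k_ι⟩`, `ι = 0, 1`, where the `x̄_i` are
`m`-tuples of variables.  The entries with `r = 0` or `r > k_ι` are not used. -/
abbrev FormulaSeq (L : FirstOrder.Language.{u, u}) (m : ℕ) : Type (u + 1) :=
  Fin 2 → ∀ r : ℕ, SemFormula L (Fin (r + 1) × Fin m)

/-- `M ⊨ ψ_{ι,r}[ā_0, …, ā_{r-1}, b̄]`. -/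
def FormulaSeq.Holds {m : ℕ} (ψ : FormulaSeq L m) (ι : Fin 2) (r : ℕ) (M : Type u)
    [L.Structure M] (a : Fin r → Fin m → M) (b : Fin m → M) : Prop :=
  ψ ι r M (fun p => (Fin.snoc a b : Fin (r + 1) → Fin m → M) p.1 p.2)

/-- The tuples `ā_α`, `α < lam`, are as required for `f̄ = ⟨f_β : β < lam⟩`, `f_β : β → {0, 1}`:
if `α_0 < … < α_{r-1} < β` and `f_β` is constantly `ι` on `[α_0, α_{r-1}]` then
`ψ_{ι,r}[ā_{α_0}, …, ā_{α_{r-1}}, ā_β]`, for `1 ≤ r ≤ k_ι`.  (For `r = 1` this says that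
`ψ_{ι,1}[ā_α, ā_β]` whenever `f_β(α) = ι`.) -/
def Realizes {m : ℕ} (ψ : FormulaSeq L m) (k : Fin 2 → ℕ) {lam : Cardinal.{u}}
    (f : lam.ord.ToType → lam.ord.ToType → Fin 2) (M : Type u) [L.Structure M]
    (a : lam.ord.ToType → Fin m → M) : Prop :=
  ∀ (ι : Fin 2) (r : ℕ), 1 ≤ r → r ≤ k ι →
    ∀ (α : Fin r → lam.ord.ToType) (β : lam.ord.ToType), StrictMono α → (∀ i, α i < β) →
      (∀ i j ξ, α i ≤ ξ → ξ ≤ α j → f β ξ = ι) →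
      ψ.Holds ι r M (fun i => a (α i)) (a β)

/-- The tuples `ā_0, …, ā_n` form the forbidden configuration: if `l_0 < … < l_{r-1} < n` with
`η(l_i) = ι` for all `i`, and `l_{r-1} < j ≤ n`, then `ψ_{ι,r}[ā_{l_0}, …, ā_{l_{r-1}}, ā_j]`,
for `1 ≤ r ≤ k_ι`. -/
def Forbidden {m n : ℕ} (ψ : FormulaSeq L m) (η : Fin n → Fin 2) (k : Fin 2 → ℕ) (M : Type u)
    [L.Structure M] (a : Fin (n + 1) → Fin m → M) : Prop :=
  ∀ (ι : Fin 2) (r : ℕ), 1 ≤ r → r ≤ k ι →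
    ∀ (l : Fin r → Fin n) (j : Fin (n + 1)), StrictMono l → (∀ i, η (l i) = ι) →
      (∀ i, (l i).castSucc < j) →
      ψ.Holds ι r M (fun i => a (l i).castSucc) (a j)

/-- The `(η, k̄, m)`-olive property of a complete first order theory. -/
def HasOlive (T : L.Theory) {n : ℕ} (η : Fin n → Fin 2) (k : Fin 2 → ℕ) (m : ℕ) : Prop :=
  ∃ φ : Fin 2 → ∀ r : ℕ, L.Formula (Fin (r + 1) × Fin m),
    (∀ lam : Cardinal.{u}, ℵ₀ ≤ lam → ∀ f : lam.ord.ToType → lam.ord.ToType → Fin 2,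
      ∃ (M : Type u) (_ : L.Structure M) (a : lam.ord.ToType → Fin m → M),
        (elemClass T).Mem M ∧ Realizes (fun ι r => ofFormula (φ ι r)) k f M a) ∧
    ∀ (M : Type u) [L.Structure M] (a : Fin (n + 1) → Fin m → M),
      (elemClass T).Mem M → ¬ Forbidden (fun ι r => ofFormula (φ ι r)) η k M a

/-- The `lam`-`(η, k̄, m)`-olive property of a class of structures with an order (in particular
of an abstract elementary class). -/
def HasOliveAEC (K : ModelClass L) (lam : Cardinal.{u}) {n : ℕ} (η : Fin n → Fin 2)
    (k : Fin 2 → ℕ) (m : ℕ) : Prop :=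
  ∃ ψ : FormulaSeq L m,
    (∀ ι r, 1 ≤ r → r ≤ k ι → UpwardPreserved K (ψ ι r)) ∧
    (∀ f : lam.ord.ToType → lam.ord.ToType → Fin 2,
      ∃ (M : Type u) (_ : L.Structure M) (a : lam.ord.ToType → Fin m → M),
        K.Mem M ∧ #M = lam ∧ Realizes ψ k f M a) ∧
    ∀ (M : Type u) [L.Structure M] (a : Fin (n + 1) → Fin m → M),
      K.Mem M → ¬ Forbidden ψ η k M a

/-- The `lam`-`(qf, η, k̄, m)`-olive property of a universal class. -/
def HasOliveQF (K : UniversalClass L) (lam : Cardinal.{u}) {n : ℕ} (η : Fin n → Fin 2)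
    (k : Fin 2 → ℕ) (m : ℕ) : Prop :=
  ∃ φ : Fin 2 → ∀ r : ℕ, L.Formula (Fin (r + 1) × Fin m),
    (∀ ι r, (φ ι r).IsQF) ∧
    (∀ f : lam.ord.ToType → lam.ord.ToType → Fin 2,
      ∃ (M : Type u) (_ : L.Structure M) (a : lam.ord.ToType → Fin m → M),
        K.Mem M ∧ Realizes (fun ι r => ofFormula (φ ι r)) k f M a) ∧
    ∀ (M : Type u) [L.Structure M] (a : Fin (n + 1) → Fin m → M),
      K.Mem M → ¬ Forbidden (fun ι r => ofFormula (φ ι r)) η k M a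

/-! ### The set theoretic condition -/

/-- `I` is a (proper) ideal on the set `S`. -/
structure IsIdealOn {A : Type u} (I : Set (Set A)) (S : Set A) : Prop where
  subset : ∀ X ∈ I, X ⊆ S
  empty_mem : ∅ ∈ I
  mono : ∀ X ∈ I, ∀ Y, Y ⊆ X → Y ∈ I
  union_mem : ∀ X ∈ I, ∀ Y ∈ I, X ∪ Y ∈ I
  proper : S ∉ I

/-- `U_I(χ)`, for an ideal `I` on `S`: the least cardinality of a family `P` of subsets of `χ`,
each of cardinality at most `|S|`, such that for every function `f` from `S` to `χ` there is
`u ∈ P` with `{a ∈ S : f(a) ∈ u}` not in `I`. -/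
noncomputable def idealU {A : Type u} (I : Set (Set A)) (S : Set A) (χ : Cardinal.{u}) :
    Cardinal.{u} :=
  sInf {c | ∃ P : Set (Set χ.out), #P = c ∧ (∀ u ∈ P, #u ≤ #S) ∧
    ∀ f : A → χ.out, ∃ u ∈ P, {a ∈ S | f a ∈ u} ∉ I}

/-- The non-accumulation points of `C`: those `γ ∈ C` with `sup (C ∩ γ) < γ`. -/
def nacc {A : Type u} [LinearOrder A] (C : Set A) : Set A :=
  {γ ∈ C | ∃ β < γ, ∀ ξ ∈ C, ξ < γ → ξ ≤ β}

/-- The condition `Qr₁(χ₂, χ₁, lam)`, for functions `g_{j,δ}` into a set `Γ` of colours.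
In the last clause `Y` is `I`-positive and, if `χ₁ > lam`, moreover `S \ Y ∈ I`.  If `χ₁ = lam`,
the ideal plays no role: one can then take `I = {∅}`. -/
def QrColours (Γ : Type u) (χ₂ χ₁ lam : Cardinal.{u}) : Prop :=
  lam.IsRegular ∧ ℵ₀ < lam ∧ lam ≤ χ₁ ∧ χ₁ < χ₂ ∧
  ∃ (S : Set lam.ord.ToType) (I : Set (Set lam.ord.ToType))
    (C : lam.ord.ToType → Set lam.ord.ToType)
    (g : χ₂.out → lam.ord.ToType → lam.ord.ToType → Γ)
    (𝒜 : χ₂.out → lam.ord.ToType → Set (Set lam.ord.ToType)),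
    IsIdealOn I S ∧
    (∀ δ ∈ S, C δ ⊆ Iio δ) ∧
    (∀ j, ∀ δ ∈ S, ∀ A ∈ 𝒜 j δ, A ⊆ nacc (C δ)) ∧
    (lam < χ₁ → idealU I S χ₁ < χ₂) ∧
    (∀ j₁ j₂, j₁ ≠ j₂ → ∀ δ ∈ S, ∀ A₁ ∈ 𝒜 j₁ δ, ∀ A₂ ∈ 𝒜 j₂ δ,
      ∃ γ ∈ A₁ ∩ A₂, g j₁ δ γ ≠ g j₂ δ γ) ∧
    (∀ j, ∀ E : Set lam.ord.ToType, IsClub E →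
      ∃ Y ⊆ S, Y ∉ I ∧ (lam < χ₁ → S \ Y ∈ I) ∧ ∀ δ ∈ Y, nacc (C δ) ∩ E ∈ 𝒜 j δ)

/-- `Qr₁(χ₂, χ₁, lam)`. -/
def Qr₁ (χ₂ χ₁ lam : Cardinal.{u}) : Prop :=
  QrColours (ULift.{u} (Fin 2)) χ₂ χ₁ lam

/-- `Qr_{1,θ}(χ₂, χ₁, lam)`. -/
def QrTheta (θ χ₂ χ₁ lam : Cardinal.{u}) : Prop :=
  QrColours θ.out χ₂ χ₁ lam

end Olive

namespace Olive

/-! ### Clubs of regular cardinals -/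

section Clubs

variable {lam : Cardinal.{u}}

/-! Suppose fewer than `χ₂` members of the class, each of size at most `χ₁`, were enough. Every `j <
χ₂` gives a function `f`: for `γ ∈ nacc (C δ)`, the row of `f` indexed by `(δ, ε)` is constant on an
interval ending at `γ`, with value bit `ε` of the colour `g j δ γ`. A structure realizing `f` embeds
into some `M i`. There one records the quadruple consisting of `i`, a guessed set `u` of at most
`lam` codes, a point `δ`, and the code in `u` of the tuples sitting at the indices `(δ, ε)`. Fewer
than `χ₂` quadruples exist, so two values of `j` share one. Their colours differ at some `γ` that
lies in both of the clubs used, so in one `M i` two sequences have a common tuple `b`, one row being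
constantly 0 and the other constantly 1 just below `γ`.

In the forbidden configuration each instance of `ψ_{ι,r}` has all its left-hand tuples at places
where `η` is `ι`. Take these from the sequence whose row is constantly `ι`; then `b` satisfies every
demand made on the next entry. Since `γ` reflects those demands, a tuple of the sequence prescribed
by `η`, with index below `γ`, satisfies them too. After `n` such steps `b` itself is the last entry.
This is `exists_forbiddenIn`; the counting is `le_univ_of_qrColours`.

Two supplements are needed. `univ` tests structures of cardinality exactly `lam`, whereas the first
order and universal versions of the olive property do not fix the cardinality; `Rich` functions
force cardinality at least `lam`, after which one passes to a small substructure. For the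
nonexistence of universal members, club guessing yields `Qr₁ (2 ^ κ) lam lam` (`qr₁_of_regular`). -/

lemma cof_toType_ord (h : lam.IsRegular) : Order.cof lam.ord.ToType = lam := by
  rw [Ordinal.cof_toType]
  exact h.cof_ord

lemma noMaxOrder_toType_ord (h : lam.IsRegular) : NoMaxOrder lam.ord.ToType :=
  Cardinal.noMaxOrder h.aleph0_le

lemma nonempty_toType_ord (h : lam.IsRegular) : Nonempty lam.ord.ToType := by
  rw [← mk_ne_zero_iff, mk_ord_toType]
  exact h.pos.ne'

lemma exists_gt_of_mk_lt (h : lam.IsRegular) (s : Set lam.ord.ToType) (hs : #s < lam) :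
    ∃ b, ∀ x ∈ s, x < b := by
  have : ¬ IsCofinal s := fun hc => by
    have := Order.cof_le hc
    rw [cof_toType_ord h] at this
    exact this.not_gt hs
  obtain ⟨b, hb⟩ := not_isCofinal_iff.1 this
  exact ⟨b, fun x hx => by simpa using hb x hx⟩

lemma exists_gt_range (h : lam.IsRegular) {ι : Type u} (hι : #ι < lam)
    (f : ι → lam.ord.ToType) : ∃ b, ∀ i, f i < b := by
  obtain ⟨b, hb⟩ := exists_gt_of_mk_lt h (range f) (mk_range_le.trans_lt hι)
  exact ⟨b, fun i => hb _ ⟨i, rfl⟩⟩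

lemma mk_Iic_toType_lt (h : lam.IsRegular) (x : lam.ord.ToType) : #(Iic x) < lam := by
  have := noMaxOrder_toType_ord h
  obtain ⟨y, hy⟩ := exists_gt x
  have hlt := mk_Iio_lt y (by simp)
  rw [mk_ord_toType] at hlt
  exact (mk_le_mk_of_subset (fun z hz => lt_of_le_of_lt hz hy : Iic x ⊆ Iio y)).trans_lt hlt

/-- For unboundedness, iterate `ω` times a map that strictly bounds `H` on initial segments. The
iterates are bounded because `lam` is regular and uncountable, and their supremum is closed under
`H`. -/
lemma isClub_closed_under (h : lam.IsRegular) (h' : ℵ₀ < lam)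
    (H : lam.ord.ToType → lam.ord.ToType) : IsClub {γ | ∀ x < γ, H x < γ} := by
  refine ⟨fun t ht _ _ a ha x hx => ?_, fun a => ?_⟩
  · obtain ⟨y, hy, hxy⟩ := (lt_isLUB_iff ha).1 hx
    exact (ht hy x hxy).trans_le (ha.1 hy)
  · have step : ∀ y : lam.ord.ToType, ∃ z, y < z ∧ ∀ x ≤ y, H x < z := by
      intro y
      obtain ⟨b, hb⟩ := exists_gt_range h (mk_Iic_toType_lt h y) (fun x => H x.1)
      have := noMaxOrder_toType_ord h
      obtain ⟨c, hc⟩ := exists_gt (max b y)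
      exact ⟨c, (le_max_right _ _).trans_lt hc,
        fun x hx => (hb ⟨x, hx⟩).trans ((le_max_left _ _).trans_lt hc)⟩
    choose G hG hG' using step
    let g : ℕ → lam.ord.ToType := fun i => G^[i] a
    have hg : ∀ i, g (i + 1) = G (g i) := fun i => Function.iterate_succ_apply' G i a
    have hne : {y | ∀ i, g i ≤ y}.Nonempty := by
      obtain ⟨b, hb⟩ := exists_gt_range h (ι := ULift.{u} ℕ) (by simpa using h')
        (fun i => g i.down)
      exact ⟨b, fun i => (hb ⟨i⟩).le⟩
    refine ⟨wellFounded_lt.min _ hne, fun x hx => ?_, wellFounded_lt.min_mem _ hne 0⟩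
    have : ∃ i, x < g i := by
      by_contra! hc
      exact wellFounded_lt.not_lt_min (s := {y | ∀ i, g i ≤ y}) hc hx
    obtain ⟨i, hi⟩ := this
    have h1 : H x < g (i + 1) := by
      rw [hg]
      exact hG' _ _ hi.le
    exact h1.trans_le (wellFounded_lt.min_mem _ hne (i + 1))

/-- `γ` reflects the predicates `P q`: whenever `P q p` has a solution and the parameters `p` are
below `γ`, then there is a solution below `γ`. -/
def Reflects {Q N A : Type*} [LT A] (P : Q → (N → A) → A → Prop) (γ : A) : Prop :=
  ∀ q p, (∀ i, p i < γ) → (∃ x, P q p x) → ∃ x < γ, P q p x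

/-- Fewer than `lam` parameter tuples lie below a given `y`, so one bound `H q y` covers a chosen
solution for each of them. The points closed under all the countably many `H q` form a club; a
finite tuple below such a point has a maximum, to which `H q` is applied. -/
lemma exists_isClub_reflects (h : lam.IsRegular) (h' : ℵ₀ < lam) {Q N : Type} [Countable Q]
    [Finite N] [Nonempty N]
    (P : Q → (N → lam.ord.ToType) → lam.ord.ToType → Prop) :
    ∃ E, IsClub E ∧ ∀ γ ∈ E, Reflects P γ := by
  classical
  have key : ∀ q, ∃ H : lam.ord.ToType → lam.ord.ToType,
      ∀ y p, (∀ i, p i ≤ y) → (∃ x, P q p x) → ∃ x < H y, P q p x := by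
    intro q
    have : ∀ y : lam.ord.ToType, ∃ z, ∀ p, (∀ i, p i ≤ y) → (∃ x, P q p x) →
        ∃ x < z, P q p x := by
      intro y
      have hcard : #(N → Iic y) < lam := by
        rcases lt_or_ge #(Iic y) ℵ₀ with hf | hi
        · have : Finite (Iic y) := lt_aleph0_iff_finite.1 hf
          exact (lt_aleph0_of_finite _).trans h'
        · have : Fintype N := Fintype.ofFinite N
          refine lt_of_le_of_lt ?_ (mk_Iic_toType_lt h y)
          simp only [mk_pi, prod_const, mk_fintype, lift_natCast, lift_uzero]
          exact_mod_cast power_nat_le hi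
      have hne := nonempty_toType_ord h
      obtain ⟨b, hb⟩ := exists_gt_range h hcard
        (fun p => if hp : ∃ x, P q (fun i => (p i).1) x then hp.choose else hne.some)
      refine ⟨b, fun p hp hx => ⟨hx.choose, ?_, hx.choose_spec⟩⟩
      have := hb (fun i => ⟨p i, hp i⟩)
      simpa only [dif_pos hx] using this
    choose H hH using this
    exact ⟨H, hH⟩
  choose H hH using key
  refine ⟨⋂ q, {γ | ∀ x < γ, H q x < γ}, IsClub.iInter_of_countable ?_
    (fun q => isClub_closed_under h h' (H q)), fun γ hγ q p hp hx => ?_⟩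
  · rw [cof_toType_ord h]
    exact h'.ne'
  · obtain ⟨i, hi⟩ := Finite.exists_max p
    obtain ⟨x, hx1, hx2⟩ := hH q (p i) p hi hx
    exact ⟨x, hx1.trans (mem_iInter.1 hγ q _ (hp i)), hx2⟩

lemma isClub_inter (h : lam.IsRegular) (h' : ℵ₀ < lam) {E F : Set lam.ord.ToType}
    (hE : IsClub E) (hF : IsClub F) : IsClub (E ∩ F) :=
  hE.inter (by rw [cof_toType_ord h]; exact h'.ne') hF

end Clubs

/-! ### Building the forbidden configuration -/

section Configuration

variable {W : Type*} (Ψ : Fin 2 → ∀ r : ℕ, (Fin r → W) → W → Prop) (k : Fin 2 → ℕ)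

/-- `Realizes`, for relations on an arbitrary set. -/
def RealizesIn {A : Type*} [LinearOrder A] (f : A → A → Fin 2) (a : A → W) : Prop :=
  ∀ (ι : Fin 2) (r : ℕ), 1 ≤ r → r ≤ k ι → ∀ (α : Fin r → A) (β : A), StrictMono α →
    (∀ i, α i < β) → (∀ i j ξ, α i ≤ ξ → ξ ≤ α j → f β ξ = ι) →
    Ψ ι r (fun i => a (α i)) (a β)

/-- `Forbidden`, for relations on an arbitrary set. -/
def ForbiddenIn {n : ℕ} (η : Fin n → Fin 2) (a : Fin (n + 1) → W) : Prop :=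
  ∀ (ι : Fin 2) (r : ℕ), 1 ≤ r → r ≤ k ι →
    ∀ (l : Fin r → Fin n) (j : Fin (n + 1)), StrictMono l → (∀ i, η (l i) = ι) →
      (∀ i, (l i).castSucc < j) → Ψ ι r (fun i => a (l i).castSucc) (a j)

/-- The element `w` is related as required in `ForbiddenIn` to the first `i` entries of `v`. -/
def Fits {n : ℕ} (η : Fin n → Fin 2) (i : ℕ) (v : Fin n → W) (w : W) : Prop :=
  ∀ (ι : Fin 2) (r : ℕ), 1 ≤ r → r ≤ k ι → ∀ s : Fin r → Fin n, StrictMono s →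
    (∀ t, η (s t) = ι) → (∀ t, (s t).val < i) → Ψ ι r (fun t => v (s t)) w

variable {Ψ k}

lemma Fits.congr {n : ℕ} {η : Fin n → Fin 2} {i : ℕ} {v v' : Fin n → W} {w : W}
    (h : Fits Ψ k η i v w) (hv : ∀ t : Fin n, t.val < i → v t = v' t) : Fits Ψ k η i v' w := by
  intro ι r h1 h2 s hs hη hi
  have : (fun t => v' (s t)) = fun t => v (s t) := funext fun t => (hv _ (hi t)).symm
  rw [this]
  exact h ι r h1 h2 s hs hη hi

lemma forbiddenIn_snoc {n : ℕ} {η : Fin n → Fin 2} {v : Fin n → W} {b : W}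
    (hv : ∀ t : Fin n, Fits Ψ k η t v (v t)) (hb : Fits Ψ k η n v b) :
    ForbiddenIn Ψ k η (Fin.snoc v b : Fin (n + 1) → W) := by
  intro ι r h1 h2 l j hl hη hj
  simp only [Fin.snoc_castSucc]
  induction j using Fin.lastCases with
  | last =>
    rw [Fin.snoc_last]
    exact hb ι r h1 h2 l hl hη fun t => (l t).2
  | cast j =>
    rw [Fin.snoc_castSucc]
    exact hv j ι r h1 h2 l hl hη fun t => hj t

variable (Ψ k)

/-- The predicates to be reflected: `x` lies above `p (inr 1)`, the function `f x` is constant on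
`[p (inr 0), p (inr 1)]`, and `a x` fits to all sequences in `U` with codes `p (inl t)`. -/
def fitPred {A : Type*} [LinearOrder A] {n : ℕ} (η : Fin n → Fin 2) (U : Set W) (e : W → A)
    (f : A → A → Fin 2) (a : A → W) (q : Fin 2 × Fin n) (p : Fin n ⊕ Fin 2 → A) (x : A) : Prop :=
  p (.inr 1) < x ∧ (∀ y, p (.inr 0) ≤ y → y ≤ p (.inr 1) → f x y = q.1) ∧ a x ∈ U ∧
    ∀ v : Fin n → W, (∀ t, t < q.2 → v t ∈ U ∧ e (v t) = p (.inl t)) → Fits Ψ k η q.2 v (a x)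

variable {Ψ k}

/-- Two sequences which realize `f 0` and `f 1` and which have a common element `b` at
positions where the functions are constant with different values on an end segment of a reflecting
`γ`, give rise to the forbidden configuration. -/
theorem exists_forbiddenIn {A : Type*} [LinearOrder A] {n : ℕ} {η : Fin n → Fin 2} {U : Set W}
    {e : W → A} (he : InjOn e U) {f : Fin 2 → A → A → Fin 2} {a : Fin 2 → A → W}
    (hreal : ∀ ι, RealizesIn Ψ k (f ι) (a ι)) {γ : A}
    (hrefl : ∀ ι, Reflects (fitPred Ψ k η U e (f ι) (a ι)) γ)
    (hclosed : ∀ ι, ∀ x < γ, e (a ι x) < γ) {β : A} (hβ : β < γ) {x : Fin 2 → A}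
    (hx : ∀ ι, γ ≤ x ι) {b : W} (hb : ∀ ι, a ι (x ι) = b) (hbU : b ∈ U)
    (hconst : ∀ ι y, β ≤ y → y < γ → f ι (x ι) y = ι) :
    ∃ v : Fin (n + 1) → W, ForbiddenIn Ψ k η v := by
  classical
  -- The entries with `η`-value `ι` all come from the sequence `a ι`, and so does `b`, at index `x
  -- ι`. Its row `f ι (x ι)` is constantly `ι` on `[β, γ)`, so the relations hold by realization.
  have fits_b : ∀ (i : ℕ) (v : Fin n → W) (y : Fin n → A),
      (∀ t, t.val < i → β ≤ y t ∧ y t < γ ∧ v t = a (η t) (y t)) →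
      (∀ t t', t'.val < i → t < t' → y t < y t') → Fits Ψ k η i v b := by
    intro i v y h1 h2 ι r hr hr' s hs hη hi
    have hv : (fun t => v (s t)) = fun t => a ι (y (s t)) := by
      funext t
      rw [(h1 _ (hi t)).2.2, hη]
    rw [hv, ← hb ι]
    exact hreal ι ι r hr hr' (fun t => y (s t)) (x ι) (fun t t' h => h2 _ _ (hi t') (hs h))
      (fun t => (h1 _ (hi t)).2.1.trans_le (hx ι))
      (fun t t' ξ h h' => hconst ι ξ ((h1 _ (hi t)).1.trans h) (h'.trans_lt (h1 _ (hi t')).2.1))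
  have main : ∀ i : ℕ, i ≤ n → ∃ (v : Fin n → W) (y : Fin n → A) (ζ : A), β ≤ ζ ∧ ζ < γ ∧
      (∀ t, t.val < i → β ≤ y t ∧ y t ≤ ζ ∧ v t = a (η t) (y t)) ∧
      (∀ t t', t'.val < i → t < t' → y t < y t') ∧
      (∀ t, t.val < i → v t ∈ U ∧ Fits Ψ k η t v (v t)) := by
    intro i
    induction i with
    | zero => exact fun _ => ⟨fun _ => b, fun _ => β, β, le_rfl, hβ, by simp⟩
    | succ i ih =>
      intro hi
      obtain ⟨v, y, ζ, hζ, hζγ, h1, h2, h3⟩ := ih (by omega)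
      let i' : Fin n := ⟨i, hi⟩
      have hb' : Fits Ψ k η i v b :=
        fits_b i v y (fun t ht => ⟨(h1 t ht).1, (h1 t ht).2.1.trans_lt hζγ, (h1 t ht).2.2⟩) h2
      -- Codes of the entries found so far, and the interval `[β, ζ]` containing their indices. The
      -- value `β` at unused places only has to be below `γ`.
      let p : Fin n ⊕ Fin 2 → A :=
        Sum.elim (fun t => if t < i' then e (v t) else β) ![β, ζ]
      have hp : ∀ z, p z < γ := by
        rintro (t | t)
        · by_cases ht : t < i'
          · simp only [p, Sum.elim_inl, if_pos ht]
            rw [(h1 t ht).2.2]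
            exact hclosed _ _ ((h1 t ht).2.1.trans_lt hζγ)
          · simpa only [p, Sum.elim_inl, if_neg ht] using hβ
        · fin_cases t
          · exact hβ
          · exact hζγ
      -- The solution to be reflected is `x (η i')`, the index of `b`, which is at least `γ`.
      -- Injectivity of `e` on `U` turns equality of codes back into equality of tuples.
      obtain ⟨x', hx'γ, hζx', hconst', hU', hfit'⟩ := hrefl (η i') (η i', i') p hp
        ⟨x (η i'), hζγ.trans_le (hx _), fun y h h' => hconst _ y h (h'.trans_lt hζγ),
          by rw [hb]; exact hbU, fun v' hv' => by
            rw [hb]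
            refine hb'.congr fun t ht => ?_
            have := hv' t ht
            have ht' : t < i' := ht
            refine (he this.1 (h3 t ht).1 ?_).symm
            rw [this.2]
            simp only [p, Sum.elim_inl, if_pos ht']⟩
      have hζx : ζ < x' := hζx'
      have hne : ∀ t : Fin n, t.val < i → t ≠ i' := by
        rintro t ht rfl
        exact lt_irrefl _ ht
      have hupd : ∀ t : Fin n, t.val < i → Function.update v i' (a (η i') x') t = v t :=
        fun t ht => Function.update_of_ne (hne t ht) _ _
      have hupd' : ∀ t : Fin n, t.val < i → Function.update y i' x' t = y t :=
        fun t ht => Function.update_of_ne (hne t ht) _ _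
      have hcase : ∀ t : Fin n, t.val < i + 1 → t.val < i ∨ t = i' := by
        intro t ht
        rcases Nat.lt_succ_iff_lt_or_eq.1 ht with h | h
        · exact .inl h
        · exact .inr (Fin.ext h)
      refine ⟨Function.update v i' (a (η i') x'), Function.update y i' x', x',
        hζ.trans hζx.le, hx'γ, ?_, ?_, ?_⟩
      · intro t ht
        rcases hcase t ht with h | rfl
        · rw [hupd t h, hupd' t h]
          exact ⟨(h1 t h).1, (h1 t h).2.1.trans hζx.le, (h1 t h).2.2⟩
        · simpa using hζ.trans hζx.le
      · intro t t' ht' htt'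
        rcases hcase t' ht' with h | rfl
        · rw [hupd' t (lt_trans htt' h), hupd' t' h]
          exact h2 t t' h htt'
        · rw [hupd' t htt', Function.update_self]
          exact (h1 t htt').2.1.trans_lt hζx
      · intro t ht
        rcases hcase t ht with h | rfl
        · rw [hupd t h]
          exact ⟨(h3 t h).1, (h3 t h).2.congr fun t' ht' => (hupd t' (lt_trans ht' h)).symm⟩
        · rw [Function.update_self]
          refine ⟨hU', (hfit' v fun t ht => ⟨(h3 t ht).1, ?_⟩).congr
            fun t' ht' => (hupd t' ht').symm⟩
          simp only [p, Sum.elim_inl]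
          rw [if_pos ht]
  obtain ⟨v, y, ζ, -, hζγ, h1, h2, h3⟩ := main n le_rfl
  exact ⟨_, forbiddenIn_snoc (fun t => (h3 t t.2).2) (fits_b n v y
    (fun t ht => ⟨(h1 t ht).1, (h1 t ht).2.1.trans_lt hζγ, (h1 t ht).2.2⟩) h2)⟩

end Configuration

/-! ### Functions which force large models -/

section Rich

variable {lam : Cardinal.{u}}

/-- The function `f` is rich: for every colouring by less than `lam` colours, for one of the
colours all possible assumptions in `RealizesIn` are met by points of this colour. -/
def Rich (f : lam.ord.ToType → lam.ord.ToType → Fin 2) : Prop :=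
  ∀ (Q : Type u) (c : lam.ord.ToType → Q), #Q < lam → ∃ q, ∀ (ι : Fin 2) (r : ℕ),
    ∃ (α : Fin r → lam.ord.ToType) (β : lam.ord.ToType), StrictMono α ∧ (∀ i, α i < β) ∧
      (∀ i j ξ, α i ≤ ξ → ξ ≤ α j → f β ξ = ι) ∧ (∀ i, c (α i) = q) ∧ c β = q

lemma exists_strictMono_of_unbounded {A : Type*} [LinearOrder A] {X : Set A}
    (hX : ∀ ρ, ∃ x ∈ X, ρ < x) (ρ : A) (r : ℕ) :
    ∃ (α : Fin r → A) (μ : A), StrictMono α ∧ ∀ i, ρ < α i ∧ α i ≤ μ ∧ α i ∈ X := by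
  choose g hgX hg using hX
  have hs : StrictMono fun i : ℕ => g^[i + 1] ρ := strictMono_nat_of_lt_succ fun i => by
    simp only [Function.iterate_succ_apply' g (i + 1)]
    exact hg _
  refine ⟨fun i => g^[i + 1] ρ, g^[r + 1] ρ, fun i j h => hs h, fun i => ⟨?_, ?_, ?_⟩⟩
  · exact lt_of_lt_of_le (hg ρ) (hs.monotone (Nat.zero_le i))
  · exact hs.monotone i.2.le
  · change g^[i.1 + 1] ρ ∈ X
    rw [Function.iterate_succ_apply']
    exact hgX _

/-- Row `x` switches from 0 to 1 at the threshold `g x`. A good colour needs unbounded thresholds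
(for `ι = 0`, put the `α i` below the threshold of `β`) and one threshold occurring unboundedly
often (for `ι = 1`, put them above it). -/
lemma rich_of_unbounded_fibers (h : lam.IsRegular)
    (f : lam.ord.ToType → lam.ord.ToType → Fin 2)
    (Z : Set lam.ord.ToType) (g : lam.ord.ToType → lam.ord.ToType)
    (hf : ∀ x ∈ Z, ∀ α, (α < g x → f x α = 0) ∧ (g x ≤ α → f x α = 1))
    (hZ : ∀ ρ μ, ∃ x ∈ Z, g x = ρ ∧ μ < x) : Rich f := by
  intro Q c hQ
  -- Otherwise choose `ρ` above all bounds for the colours with bounded thresholds. Those colours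
  -- miss the fibre of `ρ`, and the others meet it in bounded sets; being fewer than `lam`, the
  -- colours cannot cover this unbounded fibre.
  have key : ∃ q, (∀ ρ, ∃ x ∈ Z, c x = q ∧ ρ < g x) ∧
      ∃ ρ, ∀ μ, ∃ x ∈ Z, c x = q ∧ g x = ρ ∧ μ < x := by
    by_contra! hc
    have h1 : ∀ q, ∃ ρ, (∀ μ, ∃ x ∈ Z, c x = q ∧ μ < g x) ∨ ∀ x ∈ Z, c x = q → g x ≤ ρ := by
      intro q
      by_cases hq : ∀ ρ, ∃ x ∈ Z, c x = q ∧ ρ < g x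
      · exact ⟨(nonempty_toType_ord h).some, .inl hq⟩
      · push Not at hq
        obtain ⟨ρ, hρ⟩ := hq
        exact ⟨ρ, .inr hρ⟩
    choose b hb using h1
    obtain ⟨ρ, hρ⟩ := exists_gt_range h hQ b
    have h2 : ∀ q, ∃ μ, ∀ x ∈ Z, c x = q → g x = ρ → x ≤ μ := by
      intro q
      rcases hb q with hq | hq
      · exact hc q hq ρ
      · exact ⟨ρ, fun x hx hxq hxρ => absurd (hq x hx hxq) (by rw [hxρ]; exact (hρ q).not_ge)⟩
    choose μ hμ using h2
    obtain ⟨μ', hμ'⟩ := exists_gt_range h hQ μ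
    obtain ⟨x, hx, hxρ, hxμ⟩ := hZ ρ μ'
    exact ((hμ _ x hx rfl hxρ).trans_lt ((hμ' _).trans hxμ)).false
  obtain ⟨q, hq0, ρ, hq1⟩ := key
  refine ⟨q, fun ι r => ?_⟩
  fin_cases ι
  -- Thresholds of rows up to `μ` are bounded, so a row with a large enough threshold also has index
  -- above `μ`.
  · have hX : ∀ μ, ∃ x, (x ∈ Z ∧ c x = q) ∧ μ < x ∧ μ < g x := by
      intro μ
      obtain ⟨b, hb⟩ := exists_gt_range h (mk_Iic_toType_lt h μ) fun x => g x.1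
      obtain ⟨x, hx, hxq, hx'⟩ := hq0 (max b μ)
      refine ⟨x, ⟨hx, hxq⟩, ?_, (le_max_right _ _).trans_lt hx'⟩
      by_contra! hxμ
      exact ((hb ⟨x, hxμ⟩).trans ((le_max_left _ _).trans_lt hx')).false
    obtain ⟨α, μ, hα, hα'⟩ := exists_strictMono_of_unbounded (X := {x | x ∈ Z ∧ c x = q})
      (fun μ => (hX μ).imp fun x hx => ⟨hx.1, hx.2.1⟩) ρ r
    obtain ⟨β, hβ, hμ, hμ'⟩ := hX μ
    exact ⟨α, β, hα, fun i => (hα' i).2.1.trans_lt hμ, fun i j ξ _ hj =>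
      (hf β hβ.1 ξ).1 (hj.trans_lt ((hα' j).2.1.trans_lt hμ')), fun i => (hα' i).2.2.2, hβ.2⟩
  · obtain ⟨α, μ, hα, hα'⟩ := exists_strictMono_of_unbounded
      (X := {x | x ∈ Z ∧ c x = q ∧ g x = ρ})
      (fun μ => by
        obtain ⟨x, h1, h2, h3, h4⟩ := hq1 μ
        exact ⟨x, ⟨h1, h2, h3⟩, h4⟩) ρ r
    obtain ⟨β, hβ, hβq, hβρ, hβμ⟩ := hq1 μ
    exact ⟨α, β, hα, fun i => (hα' i).2.1.trans_lt hβμ, fun i j ξ hi _ =>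
      (hf β hβ ξ).2 (by rw [hβρ]; exact (hα' i).1.le.trans hi), fun i => (hα' i).2.2.2.1, hβq⟩

/-- If there were fewer than `lam` values, colour each index by its value: for a good colour `q` the
constant sequence `q` is a forbidden configuration. -/
lemma Rich.le_mk {f : lam.ord.ToType → lam.ord.ToType → Fin 2} (hf : Rich f) {W : Type u}
    {Ψ : Fin 2 → ∀ r : ℕ, (Fin r → W) → W → Prop} {k : Fin 2 → ℕ} {a : lam.ord.ToType → W}
    (ha : RealizesIn Ψ k f a) {n : ℕ} {η : Fin n → Fin 2}
    (hforb : ∀ v : Fin (n + 1) → W, ¬ ForbiddenIn Ψ k η v) : lam ≤ #W := by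
  by_contra! hW
  obtain ⟨q, hq⟩ := hf W a hW
  refine hforb (fun _ => q) fun ι r h1 h2 _ _ _ _ _ => ?_
  obtain ⟨α, β, hα, hαβ, hc, hαq, hβq⟩ := hq ι r
  have := ha ι r h1 h2 α β hα hαβ hc
  simpa only [hαq, hβq] using this

lemma mk_pi_fin_lt (h : ℵ₀ ≤ lam) {M : Type u} (hM : #M < lam) (m : ℕ) :
    #(Fin m → M) < lam := by
  rcases lt_or_ge #M ℵ₀ with hf | hi
  · have : Finite M := lt_aleph0_iff_finite.1 hf
    exact (lt_aleph0_of_finite _).trans_le h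
  · refine lt_of_le_of_lt ?_ hM
    simp only [mk_pi, prod_const, mk_fintype, lift_natCast, lift_uzero]
    exact_mod_cast power_nat_le hi

lemma Rich.le_mk_of_realizes (h : ℵ₀ ≤ lam) {L : FirstOrder.Language.{u, u}}
    {f : lam.ord.ToType → lam.ord.ToType → Fin 2} (hf : Rich f) {m n : ℕ}
    {ψ : FormulaSeq L m} {k : Fin 2 → ℕ} {η : Fin n → Fin 2} {M : Type u} [L.Structure M]
    {a : lam.ord.ToType → Fin m → M} (ha : Realizes ψ k f M a)
    (hforb : ∀ v : Fin (n + 1) → Fin m → M, ¬ Forbidden ψ η k M v) : lam ≤ #M := by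
  by_contra! hM
  exact (mk_pi_fin_lt h hM m).not_ge
    (hf.le_mk (Ψ := fun ι r => ψ.Holds ι r M) (k := k) (η := η) ha hforb)

/-- There is an enumeration of `lam` by pairs and, simultaneously, any given functions for the
pairs `(δ, some ε)` can be extended to a rich function. -/
lemma exists_rich (h : lam.IsRegular) {D : Type u} (hD : #D ≤ lam) :
    ∃ σ : lam.ord.ToType × Option D ≃ lam.ord.ToType,
      ∀ G : lam.ord.ToType → D → lam.ord.ToType → Fin 2,
        ∃ f : lam.ord.ToType → lam.ord.ToType → Fin 2, Rich f ∧
          ∀ δ ε α, f (σ (δ, some ε)) α = G δ ε α := by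
  classical
  have hσ : #(lam.ord.ToType × Option D) = #lam.ord.ToType := by
    rw [mk_prod, lift_id, lift_id, mk_option, mk_ord_toType]
    exact mul_eq_left h.aleph0_le (add_le_of_le h.aleph0_le hD (one_le_aleph0.trans h.aleph0_le))
      (by simp)
  have hτ : #(lam.ord.ToType × lam.ord.ToType) = #lam.ord.ToType := by
    rw [mk_prod, lift_id, mk_ord_toType, mul_eq_self h.aleph0_le]
  obtain ⟨σ⟩ := Cardinal.eq.1 hσ
  obtain ⟨τ⟩ := Cardinal.eq.1 hτ
  -- The rows `(δ, none)` are reserved for richness: `τ` makes each threshold occur `lam` times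
  -- among them, whatever `G` is.
  refine ⟨σ, fun G => ⟨fun x α => (σ.symm x).2.elim
    (if α < (τ.symm (σ.symm x).1).1 then 0 else 1) fun ε => G (σ.symm x).1 ε α, ?_, by simp⟩⟩
  refine rich_of_unbounded_fibers h _ {x | (σ.symm x).2 = none}
    (fun x => (τ.symm (σ.symm x).1).1) (fun x hx α => ?_) fun ρ μ => ?_
  · replace hx : (σ.symm x).2 = none := hx
    simp only [hx, Option.elim_none]
    exact ⟨fun h => if_pos h, fun h => if_neg h.not_gt⟩
  · by_contra! hc
    have hinj : Function.Injective fun y : lam.ord.ToType =>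
        (⟨σ (τ (ρ, y), none), hc _ (by simp) (by simp)⟩ : Iic μ) := by
      intro y y' hy
      simpa using congrArg Subtype.val hy
    have := mk_le_of_injective hinj
    rw [mk_ord_toType] at this
    exact this.not_gt (mk_Iic_toType_lt h μ)

end Rich

/-! ### The lower bound for `univ` -/

section Univ

variable {L : FirstOrder.Language.{u, u}} {lam χ₁ χ₂ : Cardinal.{u}}

lemma ModelClass.isStrong_equiv (K : ModelClass L) {M N : Type u} [L.Structure M] [L.Structure N]
    (e : M ≃[L] N) (hN : K.Mem N) : K.IsStrong e.toEmbedding := by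
  have : e.toEmbedding.toHom.range = ⊤ := by
    ext x
    simp only [FirstOrder.Language.Hom.mem_range, FirstOrder.Language.Substructure.mem_top,
      iff_true]
    exact ⟨e.symm x, e.apply_symm_apply x⟩
  unfold ModelClass.IsStrong
  rw [this]
  exact K.le_refl hN

/-- The infimum is attained because some family qualifies: all structures in `K` on one fixed set of
size `lam`. -/
lemma ModelClass.exists_univ (K : ModelClass L) (h : lam ≤ χ₁) :
    ∃ (ι : Type u) (M : ι → Type u) (_ : ∀ i, L.Structure (M i)),
      #ι = K.univ lam χ₁ ∧ (∀ i, K.Mem (M i) ∧ #(M i) ≤ χ₁) ∧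
      ∀ (N : Type u) [L.Structure N], K.Mem N → #N = lam →
        ∃ i, ∃ f : N ↪[L] M i, K.IsStrong f := by
  refine csInf_mem (s := {c | ∃ (ι : Type u) (M : ι → Type u) (_ : ∀ i, L.Structure (M i)),
    #ι = c ∧ (∀ i, K.Mem (M i) ∧ #(M i) ≤ χ₁) ∧
    ∀ (N : Type u) [L.Structure N], K.Mem N → #N = lam → ∃ i, ∃ f : N ↪[L] M i, K.IsStrong f})
    ⟨_, {s : L.Structure lam.out // @ModelClass.Mem L K lam.out s}, fun _ => lam.out,
      fun i => i.1, rfl, fun i => ⟨i.2, by rw [mk_out]; exact h⟩, fun N _ hN hNc => ?_⟩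
  obtain ⟨e⟩ := Cardinal.eq.1 (hNc.trans (mk_out lam).symm)
  let _ : L.Structure lam.out := e.inducedStructure
  have hmem := K.mem_iso e.inducedStructureEquiv hN
  exact ⟨⟨_, hmem⟩, e.inducedStructureEquiv.toEmbedding, K.isStrong_equiv _ hmem⟩

lemma exists_idealU {A : Type u} {I : Set (Set A)} {S : Set A} (hI : IsIdealOn I S)
    (χ : Cardinal.{u}) : ∃ P : Set (Set χ.out), #P = idealU I S χ ∧ (∀ u ∈ P, #u ≤ #S) ∧
      ∀ f : A → χ.out, ∃ u ∈ P, {a ∈ S | f a ∈ u} ∉ I := by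
  refine csInf_mem (s := {c | ∃ P : Set (Set χ.out), #P = c ∧ (∀ u ∈ P, #u ≤ #S) ∧
    ∀ f : A → χ.out, ∃ u ∈ P, {a ∈ S | f a ∈ u} ∉ I})
    ⟨_, {u | #u ≤ #S}, rfl, fun u hu => hu, fun f => ⟨f '' S, mk_image_le, ?_⟩⟩
  have : {a ∈ S | f a ∈ f '' S} = S := by
    ext a
    exact ⟨fun h => h.1, fun h => ⟨h, a, h, rfl⟩⟩
  rw [this]
  exact hI.proper

/-- A common form of the two cases `χ₁ = lam` and `χ₁ > lam` in the use of the ideal. -/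
lemma exists_guessing_family {S : Set lam.ord.ToType} {I : Set (Set lam.ord.ToType)}
    (hI : IsIdealOn I S) (h : ℵ₀ ≤ lam) (h1 : lam ≤ χ₁) (h2 : χ₁ < χ₂)
    (hU : lam < χ₁ → idealU I S χ₁ < χ₂) :
    ∃ P : Set (Set χ₁.out), #P < χ₂ ∧ (∀ u ∈ P, #u ≤ lam) ∧
      ∀ f : lam.ord.ToType → χ₁.out, ∃ u ∈ P, ∀ Y ⊆ S, Y ∉ I → (lam < χ₁ → S \ Y ∈ I) →
        ∃ δ ∈ Y, f δ ∈ u := by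
  rcases h1.eq_or_lt with rfl | hlt
  · refine ⟨{Set.univ}, ?_, by simp, fun f => ⟨Set.univ, rfl, fun Y _ hY _ => ?_⟩⟩
    · rw [mk_singleton]
      exact (one_lt_aleph0.trans_le h).trans h2
    · have : Y.Nonempty := by
        by_contra hne
        rw [not_nonempty_iff_eq_empty] at hne
        exact hY (hne ▸ hI.empty_mem)
      exact this.imp fun δ hδ => ⟨hδ, mem_univ _⟩
  · obtain ⟨P, hP, hP', hf⟩ := exists_idealU hI χ₁
    refine ⟨P, hP ▸ hU hlt, fun u hu => (hP' u hu).trans ?_, fun f => ?_⟩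
    · simpa using mk_set_le S
    · obtain ⟨u, hu, hu'⟩ := hf f
      -- The set of correct guesses is positive and the complement of `Y` is in the ideal, so they
      -- cannot be disjoint from `Y`.
      refine ⟨u, hu, fun Y _ _ hY => ?_⟩
      by_contra! hc
      exact hu' (hI.mono _ (hY hlt) _ fun δ hδ => ⟨hδ.1, fun hδY => hc δ hδY hδ.2⟩)

lemma exists_code {D M : Type u} (m : ℕ) (hχ : ℵ₀ ≤ χ₁) (hD : χ₁ ^ #D = χ₁) (hM : #M ≤ χ₁) :
    Nonempty ((D → Fin m → M) ↪ χ₁.out) := by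
  rw [← Cardinal.le_def, mk_out]
  calc #(D → Fin m → M) = (#M ^ m) ^ #D := by simp
    _ ≤ (χ₁ ^ m) ^ #D := power_le_power_right (power_le_power_right hM)
    _ ≤ χ₁ ^ #D := power_le_power_right (power_nat_le hχ)
    _ = χ₁ := hD

lemma exists_injOn {W : Type u} {A : Type u} [Nonempty A] {U : Set W} (h : #U ≤ #A) :
    ∃ e : W → A, InjOn e U := by
  classical
  obtain ⟨g⟩ := h
  refine ⟨fun w => if hw : w ∈ U then g ⟨w, hw⟩ else Classical.arbitrary A,
    fun w hw w' hw' heq => ?_⟩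
  simpa [dif_pos hw, dif_pos hw'] using heq

lemma snoc_comp {M N : Type*} (F : M → N) {r m : ℕ} (a : Fin r → Fin m → M) (b : Fin m → M) :
    (fun p : Fin (r + 1) × Fin m =>
      (Fin.snoc (fun i => F ∘ a i) (F ∘ b) : Fin (r + 1) → Fin m → N) p.1 p.2) =
      F ∘ fun p => (Fin.snoc a b : Fin (r + 1) → Fin m → M) p.1 p.2 := by
  funext ⟨s, t⟩
  induction s using Fin.lastCases with
  | last => simp
  | cast s => simp

/-- The least element of `C` above `α`, if there is one. -/
noncomputable def nextPoint {A : Type*} [LinearOrder A] [WellFoundedLT A] (C : Set A) (α : A) :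
    A := by
  classical
  exact if h : {ξ ∈ C | α < ξ}.Nonempty then wellFounded_lt.min _ h else α

/-- This supplies the interval `[β, γ)` on which rows defined through `nextPoint` are constant. -/
lemma exists_nextPoint_eq {A : Type*} [LinearOrder A] [WellFoundedLT A] {C : Set A} {γ : A}
    (hγ : γ ∈ nacc C) : ∃ β < γ, ∀ α, β ≤ α → α < γ → nextPoint C α = γ := by
  obtain ⟨hγC, β, hβ, hC⟩ := hγ
  refine ⟨β, hβ, fun α hα hαγ => ?_⟩
  have hne : {ξ ∈ C | α < ξ}.Nonempty := ⟨γ, hγC, hαγ⟩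
  unfold nextPoint
  rw [dif_pos hne]
  refine le_antisymm (not_lt.1 (wellFounded_lt.not_lt_min (s := {ξ ∈ C | α < ξ}) ⟨hγC, hαγ⟩))
    (le_of_not_gt fun hlt => ?_)
  have hmem := wellFounded_lt.min_mem _ hne
  exact (hC _ hmem.1 hlt).not_gt (hα.trans_lt hmem.2)

theorem le_univ_of_qrColours (K : ModelClass L) {m n : ℕ} (ψ : FormulaSeq L m)
    (η : Fin n → Fin 2) (k : Fin 2 → ℕ)
    (hup : ∀ ι r, 1 ≤ r → r ≤ k ι → UpwardPreserved K (ψ ι r))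
    (hreal : ∀ f : lam.ord.ToType → lam.ord.ToType → Fin 2, Rich f →
      ∃ (M : Type u) (_ : L.Structure M) (a : lam.ord.ToType → Fin m → M),
        K.Mem M ∧ #M = lam ∧ Realizes ψ k f M a)
    (hforb : ∀ (M : Type u) [L.Structure M] (a : Fin (n + 1) → Fin m → M),
      K.Mem M → ¬ Forbidden ψ η k M a)
    {D Γ : Type u} (φ : Γ → D → Fin 2) (hφ : Function.Injective φ) (hD : #D < lam)
    (hχ : χ₁ ^ #D = χ₁) (hQ : QrColours Γ χ₂ χ₁ lam) : χ₂ ≤ K.univ lam χ₁ := by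
  classical
  obtain ⟨hreg, hunc, h1, h2, S, I, C, g, 𝒜, hI, hC, h𝒜, hU, hdiff, hclub⟩ := hQ
  have := nonempty_toType_ord hreg
  by_contra! hlt
  obtain ⟨ι, M, _, hι, hM, huniv⟩ := K.exists_univ h1
  rw [← hι] at hlt
  obtain ⟨P, hP, hPc, hguess⟩ := exists_guessing_family hI hunc.le h1 h2 hU
  have hχ₁ : ℵ₀ ≤ χ₁ := hunc.le.trans h1
  let code : ∀ i, (D → Fin m → M i) ↪ χ₁.out := fun i => (exists_code m hχ₁ hχ (hM i).2).some
  -- All entries of the `D`-sequences coded in `u`. There are at most `lam` of them, so they can be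
  -- coded injectively below `lam`, as reflection requires.
  let U : ∀ i, Set χ₁.out → Set (Fin m → M i) := fun i u => {v | ∃ w ε, code i w ∈ u ∧ w ε = v}
  have he : ∀ i (u : P), ∃ e : (Fin m → M i) → lam.ord.ToType, InjOn e (U i u) := by
    intro i u
    refine exists_injOn ?_
    have hsub : U i u ⊆ range fun p : (code i ⁻¹' u.1) × D => p.1.1 p.2 := by
      rintro v ⟨w, ε, hw, rfl⟩
      exact ⟨(⟨w, hw⟩, ε), rfl⟩
    refine (mk_le_mk_of_subset hsub).trans (mk_range_le.trans ?_)
    rw [mk_prod, lift_id, lift_id, mk_ord_toType]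
    have := (mk_preimage_of_injective (code i) u.1 (code i).injective).trans (hPc u u.2)
    exact mul_le_of_le hunc.le this hD.le
  choose e he using he
  obtain ⟨σ, hσ⟩ := exists_rich hreg hD.le
  have hT : ∀ j : χ₂.out, ∃ t : ι × P × lam.ord.ToType × χ₁.out,
      ∃ (f : lam.ord.ToType → lam.ord.ToType → Fin 2) (a : lam.ord.ToType → Fin m → M t.1)
        (E : Set lam.ord.ToType),
        (∀ δ ε α, f (σ (δ, some ε)) α = φ (g j δ (nextPoint (C δ) α)) ε) ∧
        RealizesIn (fun ι r => ψ.Holds ι r (M t.1)) k f a ∧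
        (∀ γ ∈ E, Reflects (fitPred (fun ι r => ψ.Holds ι r (M t.1)) k η (U t.1 t.2.1)
            (e t.1 t.2.1) f a) γ ∧ (∀ x < γ, e t.1 t.2.1 (a x) < γ) ∧
            ∀ x < γ, (σ.symm x).1 < γ) ∧
        t.2.2.1 ∈ S ∧ nacc (C t.2.2.1) ∩ E ∈ 𝒜 j t.2.2.1 ∧
        code t.1 (fun ε => a (σ (t.2.2.1, some ε))) = t.2.2.2 ∧ t.2.2.2 ∈ t.2.1.1 := by
    intro j
    obtain ⟨f, hfr, hf⟩ := hσ fun δ ε α => φ (g j δ (nextPoint (C δ) α)) ε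
    obtain ⟨N, _, a, hN, hNc, ha⟩ := hreal f hfr
    obtain ⟨i, F, hF⟩ := huniv N hN hNc
    let a' : lam.ord.ToType → Fin m → M i := fun x => F ∘ a x
    have ha' : RealizesIn (fun ι r => ψ.Holds ι r (M i)) k f a' := by
      intro ι r hr hr' α β hα hαβ hc
      have := hup ι r hr hr' F hF _ (ha ι r hr hr' α β hα hαβ hc)
      rwa [← snoc_comp] at this
    obtain ⟨u, hu, hu'⟩ := hguess fun δ => code i fun ε => a' (σ (δ, some ε))
    obtain ⟨E, hE, hE'⟩ := exists_isClub_reflects hreg hunc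
      (fitPred (fun ι r => ψ.Holds ι r (M i)) k η (U i u) (e i ⟨u, hu⟩) f a')
    have hE₂ := isClub_inter hreg hunc hE (isClub_inter hreg hunc
      (isClub_closed_under hreg hunc fun x => e i ⟨u, hu⟩ (a' x))
      (isClub_closed_under hreg hunc fun x => (σ.symm x).1))
    obtain ⟨Y, hYS, hYI, hYI', hY⟩ := hclub j _ hE₂
    obtain ⟨δ, hδ, hδu⟩ := hu' Y hYS hYI hYI'
    exact ⟨(i, ⟨u, hu⟩, δ, _), f, a', _, hf, ha', fun γ hγ => ⟨hE' γ hγ.1, hγ.2.1, hγ.2.2⟩,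
      hYS hδ, hY δ hδ, rfl, hδu⟩
  choose T hT using hT
  -- Pigeonhole: each of the four factors of the target has size below `χ₂`.
  have hninj : ¬ Function.Injective T := fun hinj => by
    have := mk_le_of_injective hinj
    refine this.not_gt ?_
    have hχ₂ : ℵ₀ ≤ χ₂ := hχ₁.trans h2.le
    simp only [mk_prod, lift_id, mk_out, mk_ord_toType]
    exact mul_lt_of_lt hχ₂ hlt (mul_lt_of_lt hχ₂ hP (mul_lt_of_lt hχ₂ (h1.trans_lt h2) h2))
  simp only [Function.Injective, not_forall] at hninj
  obtain ⟨j₁, j₂, heq, hne⟩ := hninj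
  have hT₁ := hT j₁
  have hT₂ := hT j₂
  rw [← heq] at hT₂
  generalize T j₁ = t at hT₁ hT₂
  obtain ⟨i, u, δ, y⟩ := t
  obtain ⟨f₁, a₁, E₁, hf₁, ha₁, hE₁, hδ, hA₁, hy₁, hu⟩ := hT₁
  obtain ⟨f₂, a₂, E₂, hf₂, ha₂, hE₂, -, hA₂, hy₂, -⟩ := hT₂
  dsimp only at *
  obtain ⟨γ, ⟨hγ₁, hγ₂⟩, hγ⟩ := hdiff j₁ j₂ hne δ hδ _ hA₁ _ hA₂
  -- The colours are separated by some bit `ε`; only the row `(δ, some ε)` matters from here on.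
  obtain ⟨ε, hε⟩ := Function.ne_iff.1 (hφ.ne hγ)
  have hγn : γ ∈ nacc (C δ) := hγ₁.1
  obtain ⟨β, hβ, hnext⟩ := exists_nextPoint_eq hγn
  have hγδ : γ < δ := hC δ hδ hγn.1
  -- An index below `γ` would have first coordinate `δ < γ` by the closure of the club, but `γ < δ`.
  have hx : γ ≤ σ (δ, some ε) := by
    by_contra! hc
    have := (hE₁ γ hγ₁.2).2.2 _ hc
    rw [Equiv.symm_apply_apply] at this
    exact this.not_gt hγδ
  have hb : a₁ (σ (δ, some ε)) = a₂ (σ (δ, some ε)) :=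
    congrFun ((code i).injective (hy₁.trans hy₂.symm)) ε
  have hbU : a₁ (σ (δ, some ε)) ∈ U i u := ⟨_, ε, by rw [hy₁]; exact hu, rfl⟩
  have hc₁ : ∀ z, β ≤ z → z < γ → f₁ (σ (δ, some ε)) z = φ (g j₁ δ γ) ε := fun z hz hz' => by
    rw [hf₁, hnext z hz hz']
  have hc₂ : ∀ z, β ≤ z → z < γ → f₂ (σ (δ, some ε)) z = φ (g j₂ δ γ) ε := fun z hz hz' => by
    rw [hf₂, hnext z hz hz']
  have fin2 : ∀ p q : Fin 2, p ≠ q → p = 0 ∧ q = 1 ∨ p = 1 ∧ q = 0 := by decide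
  rcases fin2 _ _ hε with ⟨h0, h1⟩ | ⟨h1, h0⟩
  · rw [h0] at hc₁
    rw [h1] at hc₂
    obtain ⟨v, hv⟩ := exists_forbiddenIn (he i u) (f := ![f₁, f₂]) (a := ![a₁, a₂])
      (Fin.forall_fin_two.2 ⟨ha₁, ha₂⟩)
      (Fin.forall_fin_two.2 ⟨(hE₁ γ hγ₁.2).1, (hE₂ γ hγ₂.2).1⟩)
      (Fin.forall_fin_two.2 ⟨(hE₁ γ hγ₁.2).2.1, (hE₂ γ hγ₂.2).2.1⟩) hβ
      (x := fun _ => σ (δ, some ε)) (fun _ => hx) (Fin.forall_fin_two.2 ⟨rfl, hb.symm⟩) hbU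
      (Fin.forall_fin_two.2 ⟨hc₁, hc₂⟩)
    exact hforb (M i) v (hM i).1 hv
  · rw [h1] at hc₁
    rw [h0] at hc₂
    obtain ⟨v, hv⟩ := exists_forbiddenIn (he i u) (f := ![f₂, f₁]) (a := ![a₂, a₁])
      (Fin.forall_fin_two.2 ⟨ha₂, ha₁⟩)
      (Fin.forall_fin_two.2 ⟨(hE₂ γ hγ₂.2).1, (hE₁ γ hγ₁.2).1⟩)
      (Fin.forall_fin_two.2 ⟨(hE₂ γ hγ₂.2).2.1, (hE₁ γ hγ₁.2).2.1⟩) hβ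
      (x := fun _ => σ (δ, some ε)) (fun _ => hx) (Fin.forall_fin_two.2 ⟨hb.symm, rfl⟩) hbU
      (Fin.forall_fin_two.2 ⟨hc₂, hc₁⟩)
    exact hforb (M i) v (hM i).1 hv

end Univ

/-! ### Club guessing -/

section Guessing

/-- `C` is an unbounded subset of the points below `δ`. -/
def IsUnboundedBelow {A : Type*} [LT A] (C : Set A) (δ : A) : Prop :=
  (∀ x ∈ C, x < δ) ∧ ∀ x < δ, ∃ y ∈ C, x < y

/-- `δ` is a point of cofinality `κ`. -/
def HasCof {A : Type u} [LT A] (κ : Cardinal.{u}) (δ : A) : Prop :=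
  (∃ C, IsUnboundedBelow C δ ∧ #C ≤ κ) ∧ ∀ C, IsUnboundedBelow C δ → κ ≤ #C

variable {κ lam : Cardinal.{u}}

lemma exists_isLUB_of_bddAbove {A : Type*} [LinearOrder A] [WellFoundedLT A] {t : Set A}
    (h : BddAbove t) : ∃ x, IsLUB t x :=
  ⟨wellFounded_lt.min _ h, wellFounded_lt.min_mem _ h, fun _ hy =>
    not_lt.1 (wellFounded_lt.not_lt_min (s := upperBounds t) hy)⟩

lemma exists_isGreatest_of_isClub {A : Type*} [LinearOrder A] [WellFoundedLT A] {E : Set A}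
    (hE : IsClub E) {α : A} (h : (E ∩ Iic α).Nonempty) : ∃ x, IsGreatest (E ∩ Iic α) x := by
  have hα : α ∈ upperBounds (E ∩ Iic α) := fun y hy => hy.2
  obtain ⟨x, hx⟩ := exists_isLUB_of_bddAbove ⟨α, hα⟩
  exact ⟨x, ⟨hE.isLUB_mem inter_subset_left h hx, hx.2 hα⟩, hx.1⟩

/-- `δ` is the supremum of a strictly increasing `κ`-sequence in `E`. It exists since `κ < lam`, and
regularity of `κ` excludes smaller unbounded sets. -/
lemma exists_hasCof (hκ : κ.IsRegular) (h : lam.IsRegular) (hlt : κ < lam)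
    {E : Set lam.ord.ToType} (hE : IsClub E) :
    ∃ δ, HasCof κ δ ∧ ∀ x < δ, ∃ y ∈ E, x < y ∧ y < δ := by
  have hnm := noMaxOrder_toType_ord h
  have hnmκ := noMaxOrder_toType_ord hκ
  have step : ∀ (i : κ.ord.ToType) (e : ∀ j : κ.ord.ToType, j < i → lam.ord.ToType),
      ∃ y ∈ E, ∀ j hj, e j hj < y := by
    intro i e
    have hi : #(Iio i) < lam :=
      ((mk_le_mk_of_subset Iio_subset_Iic_self).trans_lt (mk_Iic_toType_lt hκ i)).trans hlt
    obtain ⟨b, hb⟩ := exists_gt_range h hi fun j => e j.1 j.2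
    obtain ⟨y, hy, hby⟩ := hE.isCofinal b
    exact ⟨y, hy, fun j hj => (hb ⟨j, hj⟩).trans_le hby⟩
  choose G hGE hG using step
  let e : κ.ord.ToType → lam.ord.ToType := wellFounded_lt.fix G
  have he : ∀ i, e i = G i fun j _ => e j := fun i => wellFounded_lt.fix_eq G i
  have heE : ∀ i, e i ∈ E := fun i => by rw [he]; exact hGE _ _
  have hmono : StrictMono e := fun j i hji => by
    rw [he i]
    exact hG i (fun j _ => e j) j hji
  have hbdd : BddAbove (range e) := by
    obtain ⟨b, hb⟩ := exists_gt_range h (by rwa [mk_ord_toType]) e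
    exact ⟨b, by rintro _ ⟨i, rfl⟩; exact (hb i).le⟩
  obtain ⟨δ, hδ⟩ := exists_isLUB_of_bddAbove hbdd
  have hlt : ∀ i, e i < δ := fun i => by
    obtain ⟨j, hj⟩ := exists_gt i
    exact (hmono hj).trans_le (hδ.1 ⟨j, rfl⟩)
  have hex : ∀ x < δ, ∃ i, x < e i := fun x hx => by
    obtain ⟨_, ⟨i, rfl⟩, hi⟩ := (lt_isLUB_iff hδ).1 hx
    exact ⟨i, hi⟩
  refine ⟨δ, ⟨⟨range e, ⟨by rintro _ ⟨i, rfl⟩; exact hlt i, fun x hx => ?_⟩, ?_⟩, ?_⟩, ?_⟩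
  · obtain ⟨i, hi⟩ := hex x hx
    exact ⟨_, ⟨i, rfl⟩, hi⟩
  · exact mk_range_le.trans (by rw [mk_ord_toType])
  · intro C hC
    by_contra! hcard
    choose idx hidx using fun y : C => hex y (hC.1 y y.2)
    obtain ⟨b, hb⟩ := exists_gt_range hκ hcard idx
    obtain ⟨y, hy, hby⟩ := hC.2 _ (hlt b)
    exact lt_asymm (hmono (hb ⟨y, hy⟩)) (hby.trans (hidx ⟨y, hy⟩))
  · intro x hx
    obtain ⟨i, hi⟩ := hex x hx
    exact ⟨_, heE i, hi, hlt i⟩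

/-- The greatest elements of the set `E` below (or equal to) elements of `C`. -/
def project {A : Type*} [LinearOrder A] (C E : Set A) : Set A :=
  {x | ∃ α ∈ C, IsGreatest (E ∩ Iic α) x}

/-- A decreasing sequence of clubs of length `κ⁺` stabilizes, as far as `project C` for a set `C` of
cardinality at most `κ` is concerned. -/
lemma exists_project_subset (hκ : ℵ₀ ≤ κ) {A : Type u} [LinearOrder A] [WellFoundedLT A]
    {E : (Order.succ κ).ord.ToType → Set A} (hE : ∀ i, IsClub (E i)) (hanti : Antitone E)
    {C : Set A} (hC : #C ≤ κ) : ∃ i, ∀ j ≥ i, project C (E i) ⊆ E j := by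
  have hreg : (Order.succ κ).IsRegular := isRegular_succ hκ
  have := nonempty_toType_ord hreg
  have key : ∀ α : A, ∃ i, ∀ i' ≥ i, ∀ j ≥ i', ∀ x, IsGreatest (E i' ∩ Iic α) x → x ∈ E j := by
    intro α
    by_cases hne : ∀ i, (E i ∩ Iic α).Nonempty
    · choose p hp using fun i => exists_isGreatest_of_isClub (hE i) (hne i)
      -- As the clubs shrink, the greatest element up to `α` can only decrease, so by
      -- well-foundedness it is constant from some stage on.
      obtain ⟨i, hi⟩ : ∃ i, ∀ j, p i ≤ p j := by
        have hr : (range p).Nonempty := range_nonempty p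
        obtain ⟨i, hi⟩ := wellFounded_lt.min_mem _ hr
        exact ⟨i, fun j => by
          rw [hi]
          exact not_lt.1 (wellFounded_lt.not_lt_min (s := range p) ⟨j, rfl⟩)⟩
      refine ⟨i, fun i' hi' j hj x hx => ?_⟩
      have h1 : x ≤ p i := (hp i).2 ⟨hanti hi' hx.1.1, hx.1.2⟩
      have h2 : p j ≤ x := hx.2 ⟨hanti hj (hp j).1.1, (hp j).1.2⟩
      have h3 : x = p j := le_antisymm (h1.trans (hi j)) h2
      rw [h3]
      exact (hp j).1.1
    · push Not at hne
      obtain ⟨i, hi⟩ := hne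
      refine ⟨i, fun i' hi' j _ x hx => ?_⟩
      have : x ∈ E i ∩ Iic α := ⟨hanti hi' hx.1.1, hx.1.2⟩
      rw [hi] at this
      exact this.elim
  choose i hi using key
  obtain ⟨b, hb⟩ := exists_gt_range hreg (hC.trans_lt (Order.lt_succ κ)) fun α : C => i α
  refine ⟨b, fun j hj => ?_⟩
  rintro x ⟨α, hα, hx⟩
  exact hi α b (hb ⟨α, hα⟩).le j hj x hx

lemma isUnboundedBelow_project {A : Type*} [LinearOrder A] [WellFoundedLT A] {C E : Set A}
    (hE : IsClub E) {δ : A} (hC : IsUnboundedBelow C δ) (hδ : ∀ x < δ, ∃ y ∈ E, x < y ∧ y < δ) :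
    IsUnboundedBelow (project C E) δ := by
  constructor
  · rintro x ⟨α, hα, hx⟩
    exact lt_of_le_of_lt hx.1.2 (hC.1 α hα)
  · intro x hx
    obtain ⟨y, hy, hxy, hyδ⟩ := hδ x hx
    obtain ⟨α, hα, hyα⟩ := hC.2 y hyδ
    obtain ⟨z, hz⟩ := exists_isGreatest_of_isClub hE ⟨y, hy, hyα.le⟩
    exact ⟨z, ⟨α, hα, hz⟩, hxy.trans_le (hz.2 ⟨hy, hyα.le⟩)⟩

/-- Club guessing at points of cofinality `κ` with `κ⁺ < lam`. -/
theorem exists_club_guessing (hκ : κ.IsRegular) (h : lam.IsRegular) (hlt : Order.succ κ < lam) :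
    ∃ (S : Set lam.ord.ToType) (D : lam.ord.ToType → Set lam.ord.ToType),
      (∀ δ ∈ S, HasCof κ δ ∧ IsUnboundedBelow (D δ) δ) ∧
      ∀ E, IsClub E → ∃ δ ∈ S, D δ ⊆ E := by
  classical
  have hκlam : κ < lam := (Order.lt_succ κ).trans hlt
  have hunc : ℵ₀ < lam := hκ.aleph0_le.trans_lt hκlam
  have hcof : Order.cof lam.ord.ToType ≠ ℵ₀ := by
    rw [cof_toType_ord h]
    exact hunc.ne'
  have hC : ∀ δ : lam.ord.ToType, ∃ C, HasCof κ δ → IsUnboundedBelow C δ ∧ #C ≤ κ := by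
    intro δ
    by_cases hδ : HasCof κ δ
    · obtain ⟨C, hC⟩ := hδ.1
      exact ⟨C, fun _ => hC⟩
    · exact ⟨∅, fun h => absurd h hδ⟩
  choose C hC using hC
  suffices hs : ∃ E, IsClub E ∧ ∀ E', IsClub E' → ∃ δ, HasCof κ δ ∧
      (∀ x < δ, ∃ y ∈ E, x < y ∧ y < δ) ∧ project (C δ) E ⊆ E' by
    obtain ⟨E, hE, hE'⟩ := hs
    refine ⟨{δ | HasCof κ δ ∧ ∀ x < δ, ∃ y ∈ E, x < y ∧ y < δ}, fun δ => project (C δ) E,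
      fun δ hδ => ⟨hδ.1, isUnboundedBelow_project hE (hC δ hδ.1).1 hδ.2⟩, fun E' hEc => ?_⟩
    obtain ⟨δ, h1, h2, h3⟩ := hE' E' hEc
    exact ⟨δ, ⟨h1, h2⟩, h3⟩
  by_contra! hc
  have hΦ : ∀ E : Set lam.ord.ToType, ∃ E', IsClub E → IsClub E' ∧ ∀ δ, HasCof κ δ →
      (∀ x < δ, ∃ y ∈ E, x < y ∧ y < δ) → ¬ project (C δ) E ⊆ E' := by
    intro E
    by_cases hE : IsClub E
    · obtain ⟨E', hE'⟩ := hc E hE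
      exact ⟨E', fun _ => hE'⟩
    · exact ⟨∅, fun h => absurd h hE⟩
  choose Φ hΦ using hΦ
  have hregs : (Order.succ κ).IsRegular := isRegular_succ hκ.aleph0_le
  -- Each club is contained in the counterexamples to all earlier ones. The hypothesis `κ⁺ < lam`
  -- keeps even the full intersection a club.
  let E : (Order.succ κ).ord.ToType → Set lam.ord.ToType :=
    wellFounded_lt.fix fun i e => ⋂ j : Iio i, Φ (e j.1 j.2)
  have hE : ∀ i, E i = ⋂ j : Iio i, Φ (E j) := fun i => wellFounded_lt.fix_eq _ i
  have hclub : ∀ i, IsClub (E i) := by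
    intro i
    induction i using WellFoundedLT.induction with
    | _ i ih =>
      rw [hE]
      refine IsClub.iInter hcof ?_ fun j => (hΦ _ (ih j.1 j.2)).1
      rw [cof_toType_ord h, lift_id, lift_id]
      exact ((mk_le_mk_of_subset Iio_subset_Iic_self).trans_lt (mk_Iic_toType_lt hregs i)).trans
        hlt
  have hsub : ∀ i j, i < j → E j ⊆ Φ (E i) := by
    intro i j hij
    rw [hE j]
    exact iInter_subset (fun k : Iio j => Φ (E k)) ⟨i, hij⟩
  have hanti : Antitone E := by
    intro i j hij
    rw [hE i]
    exact subset_iInter fun k => hsub k j (lt_of_lt_of_le k.2 hij)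
  have hall : IsClub (⋂ i, E i) := by
    refine IsClub.iInter hcof ?_ hclub
    rw [cof_toType_ord h, lift_id, lift_id, mk_ord_toType]
    exact hlt
  obtain ⟨δ, hδ, hacc⟩ := exists_hasCof hκ h hκlam hall
  obtain ⟨i, hi⟩ := exists_project_subset hκ.aleph0_le hclub hanti (hC δ hδ).2
  have := noMaxOrder_toType_ord hregs
  obtain ⟨j, hj⟩ := exists_gt i
  -- After stabilization the projection to `E i` lies in the later `E j`, hence in the set `Φ (E i)`
  -- chosen to refute it.
  refine (hΦ _ (hclub i)).2 δ hδ (fun x hx => ?_) ((hi j hj.le).trans (hsub i j hj))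
  obtain ⟨y, hy, hxy⟩ := hacc x hx
  exact ⟨y, mem_iInter.1 hy i, hxy⟩

lemma isUnboundedBelow_nacc {A : Type*} [LinearOrder A] [WellFoundedLT A] {D : Set A} {δ : A}
    (hD : IsUnboundedBelow D δ) : IsUnboundedBelow (nacc D) δ := by
  refine ⟨fun x hx => hD.1 x hx.1, fun x hx => ?_⟩
  have hne : {y ∈ D | x < y}.Nonempty := hD.2 x hx
  have hmem := wellFounded_lt.min_mem _ hne
  refine ⟨_, ⟨hmem.1, x, hmem.2, fun ξ hξ hlt => ?_⟩, hmem.2⟩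
  by_contra! hxξ
  exact wellFounded_lt.not_lt_min (s := {y ∈ D | x < y}) ⟨hξ, hxξ⟩ hlt

/-- Index the `2 ^ κ` colourings by functions from `κ` to 2 and read them along a surjection of
`nacc (D δ)` onto `κ`. Distinct functions then differ at some point of `nacc (D δ)`, and guessing
puts all of that set into the club. -/
theorem qr₁_of_regular (hκ : κ.IsRegular) (h : lam.IsRegular) (hlt : Order.succ κ < lam)
    (hpow : lam < 2 ^ κ) : Qr₁ (2 ^ κ) lam lam := by
  classical
  obtain ⟨S, D, hSD, hguess⟩ := exists_club_guessing hκ h hlt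
  have hκlam : κ < lam := (Order.lt_succ κ).trans hlt
  have hS : S.Nonempty := by
    obtain ⟨δ, hδ, -⟩ := hguess univ IsClub.univ
    exact ⟨δ, hδ⟩
  have : Nonempty κ.out := by
    rw [← mk_ne_zero_iff, mk_out]
    exact hκ.pos.ne'
  have hidx : ∀ δ, ∃ idx : lam.ord.ToType → κ.out, δ ∈ S →
      ∀ i, ∃ γ ∈ nacc (D δ), idx γ = i := by
    intro δ
    by_cases hδ : δ ∈ S
    · have hle := (hSD δ hδ).1.2 _ (isUnboundedBelow_nacc (hSD δ hδ).2)
      rw [← mk_out κ] at hle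
      obtain ⟨t⟩ := hle
      refine ⟨Function.invFun fun i => (t i).1, fun _ i => ⟨_, (t i).2, ?_⟩⟩
      exact Function.leftInverse_invFun (Subtype.val_injective.comp t.injective) i
    · exact ⟨fun _ => Classical.arbitrary _, fun h => absurd h hδ⟩
  choose idx hidx using hidx
  have hcard : #((2 ^ κ : Cardinal.{u}).out) = #(κ.out → ULift.{u} (Fin 2)) := by simp
  obtain ⟨H⟩ := Cardinal.eq.1 hcard
  refine ⟨h, hκ.aleph0_le.trans_lt hκlam, le_rfl, hpow, S, {∅}, D,
    fun j δ γ => H j (idx δ γ), fun _ δ => {nacc (D δ)}, ⟨?_, rfl, ?_, ?_, ?_⟩,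
    fun δ hδ x hx => (hSD δ hδ).2.1 x hx, ?_, fun h => absurd h (lt_irrefl _), ?_, ?_⟩
  · rintro _ rfl
    exact empty_subset _
  · rintro _ rfl Y hY
    exact subset_empty_iff.1 hY
  · rintro _ rfl _ rfl
    exact empty_union _
  · exact fun hc => hS.ne_empty hc
  · rintro j δ hδ _ rfl
    exact subset_rfl
  · rintro j₁ j₂ hj δ hδ _ rfl _ rfl
    obtain ⟨i, hi⟩ := Function.ne_iff.1 (H.injective.ne hj)
    obtain ⟨γ, hγ, rfl⟩ := hidx δ hδ i
    exact ⟨γ, ⟨hγ, hγ⟩, hi⟩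
  · intro j E hE
    obtain ⟨δ, hδ, hsub⟩ := hguess E hE
    refine ⟨{δ}, singleton_subset_iff.2 hδ, fun hc => ?_, fun h => absurd h (lt_irrefl _), ?_⟩
    · exact singleton_ne_empty δ hc
    · rintro _ rfl
      exact inter_eq_left.2 fun x hx => hsub hx.1

end Guessing

/-! ### Elementary classes and universal classes -/

section Classes

variable {L : FirstOrder.Language.{u, u}}

lemma realize_of_isStrong_elemClass {T : L.Theory} {M N : Type u} [L.Structure M] [L.Structure N]
    (f : M ↪[L] N) (hf : (elemClass T).IsStrong f) {I : Type} (φ : L.Formula I) (x : I → M) :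
    φ.Realize (f ∘ x) ↔ φ.Realize x := by
  let S : L.ElementarySubstructure N := ⟨f.toHom.range, hf.2⟩
  have h1 := f.equivRange.toElementaryEmbedding.map_formula φ x
  have h2 := S.subtype.map_formula φ (f.equivRange.toElementaryEmbedding ∘ x)
  rw [← h1, ← h2]
  rfl

lemma realize_isQF_embedding {M N : Type*} [L.Structure M] [L.Structure N] (f : M ↪[L] N)
    {I : Type*} {n : ℕ} {φ : L.BoundedFormula I n} (hφ : φ.IsQF) (v : I → M) (xs : Fin n → M) :
    φ.Realize (f ∘ v) (f ∘ xs) ↔ φ.Realize v xs := by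
  induction hφ with
  | falsum => exact Iff.rfl
  | of_isAtomic h =>
    cases h with
    | equal t₁ t₂ =>
      simp only [FirstOrder.Language.BoundedFormula.realize_bdEqual, ← Sum.comp_elim,
        FirstOrder.Language.HomClass.realize_term]
      exact f.injective.eq_iff
    | rel R ts =>
      simp only [FirstOrder.Language.BoundedFormula.realize_rel, ← Sum.comp_elim,
        FirstOrder.Language.HomClass.realize_term]
      exact f.map_rel R _
  | imp _ _ ih₁ ih₂ => simp only [FirstOrder.Language.BoundedFormula.realize_imp, ih₁, ih₂]

lemma realize_formula_isQF_embedding {M N : Type*} [L.Structure M] [L.Structure N] (f : M ↪[L] N)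
    {I : Type*} {φ : L.Formula I} (hφ : φ.IsQF) (v : I → M) :
    φ.Realize (f ∘ v) ↔ φ.Realize v := by
  have := realize_isQF_embedding f hφ v default
  rwa [Subsingleton.elim (f ∘ (default : Fin 0 → M)) default] at this

lemma Realizes.of_comp {m : ℕ} {φ : Fin 2 → ∀ r : ℕ, L.Formula (Fin (r + 1) × Fin m)}
    {k : Fin 2 → ℕ} {lam : Cardinal.{u}} {f : lam.ord.ToType → lam.ord.ToType → Fin 2}
    {M N : Type u} [L.Structure M] [L.Structure N] {F : M → N}
    (hF : ∀ ι r x, (φ ι r).Realize (F ∘ x) ↔ (φ ι r).Realize x)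
    {a : lam.ord.ToType → Fin m → M}
    (h : Realizes (fun ι r => ofFormula (φ ι r)) k f N fun x => F ∘ a x) :
    Realizes (fun ι r => ofFormula (φ ι r)) k f M a := by
  intro ι r hr hr' α β hα hαβ hc
  have := h ι r hr hr' α β hα hαβ hc
  unfold FormulaSeq.Holds ofFormula at this ⊢
  rw [snoc_comp] at this
  exact (hF _ _ _).1 this

lemma mk_range_uncurry_le {lam : Cardinal.{u}} (h : ℵ₀ ≤ lam) {M : Type u} {m : ℕ}
    (a : lam.ord.ToType → Fin m → M) :
    #(range fun p : lam.ord.ToType × ULift.{u} (Fin m) => a p.1 p.2.down) ≤ lam := by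
  refine mk_range_le.trans ?_
  rw [mk_prod, lift_id, lift_id, mk_ord_toType]
  exact mul_le_of_le h le_rfl ((lt_aleph0_of_finite _).le.trans h)

/-- A common form of the olive properties, for structures of cardinality `lam`. -/
def RichOlive (K : ModelClass L) (lam : Cardinal.{u}) {n : ℕ} (η : Fin n → Fin 2)
    (k : Fin 2 → ℕ) (m : ℕ) : Prop :=
  ∃ ψ : FormulaSeq L m, (∀ ι r, 1 ≤ r → r ≤ k ι → UpwardPreserved K (ψ ι r)) ∧
    (∀ f : lam.ord.ToType → lam.ord.ToType → Fin 2, Rich f →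
      ∃ (M : Type u) (_ : L.Structure M) (a : lam.ord.ToType → Fin m → M),
        K.Mem M ∧ #M = lam ∧ Realizes ψ k f M a) ∧
    ∀ (M : Type u) [L.Structure M] (a : Fin (n + 1) → Fin m → M),
      K.Mem M → ¬ Forbidden ψ η k M a

variable {n m : ℕ} {η : Fin n → Fin 2} {k : Fin 2 → ℕ} {lam : Cardinal.{u}}

lemma HasOliveAEC.richOlive {K : ModelClass L} (h : HasOliveAEC K lam η k m) :
    RichOlive K lam η k m := by
  obtain ⟨ψ, h1, h2, h3⟩ := h
  exact ⟨ψ, h1, fun f _ => h2 f, h3⟩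

/-- Richness gives a model of size at least `lam`; downward Löwenheim-Skolem around the tuples gives
size exactly `lam`. -/
lemma HasOlive.richOlive {T : L.Theory} (hlam : ℵ₀ ≤ lam) (hL : L.card ≤ lam)
    (h : HasOlive T η k m) : RichOlive (elemClass T) lam η k m := by
  obtain ⟨φ, h2, h3⟩ := h
  refine ⟨fun ι r => ofFormula (φ ι r), fun ι r _ _ M N _ _ F hF x hx =>
    (realize_of_isStrong_elemClass F hF _ x).2 hx, fun f hf => ?_, h3⟩
  obtain ⟨M, _, a, hM, ha⟩ := h2 lam hlam f
  have hle : lam ≤ #M := hf.le_mk_of_realizes hlam ha fun v => h3 M v hM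
  obtain ⟨S, hS, hSc⟩ := FirstOrder.Language.exists_elementarySubstructure_card_eq L
    (range fun p : lam.ord.ToType × ULift.{u} (Fin m) => a p.1 p.2.down) lam hlam
    (by simpa using mk_range_uncurry_le hlam a) (by simpa using hL) (by simpa using hle)
  have hmem : ∀ x i, a x i ∈ S := fun x i => hS ⟨(x, ⟨i⟩), rfl⟩
  obtain ⟨h0, hT⟩ := hM
  refine ⟨S, inferInstance, fun x i => ⟨a x i, hmem x i⟩, ⟨inferInstance, inferInstance⟩,
    by simpa using hSc, Realizes.of_comp (F := S.subtype) (fun ι r x => S.subtype.map_formula _ x) ha⟩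

/-- The substructure generated by the tuples has size at most `lam`, and still realizes `f` because
the formulas are quantifier free. Richness, applied to this substructure itself, gives the other
inequality. -/
lemma HasOliveQF.richOlive {K : UniversalClass L} (hlam : ℵ₀ ≤ lam) (hL : L.card ≤ lam)
    (h : HasOliveQF K lam η k m) : RichOlive K.toModelClass lam η k m := by
  obtain ⟨φ, h1, h2, h3⟩ := h
  refine ⟨fun ι r => ofFormula (φ ι r), fun ι r _ _ M N _ _ F _ x hx =>
    (realize_formula_isQF_embedding F (h1 ι r) x).2 hx, fun f hf => ?_, h3⟩
  obtain ⟨M, _, a, hM, ha⟩ := h2 f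
  let s : Set M := range fun p : lam.ord.ToType × ULift.{u} (Fin m) => a p.1 p.2.down
  let S : L.Substructure M := FirstOrder.Language.Substructure.closure L s
  have hmem : ∀ x i, a x i ∈ S := fun x i =>
    FirstOrder.Language.Substructure.subset_closure ⟨(x, ⟨i⟩), rfl⟩
  have ha' : Realizes (fun ι r => ofFormula (φ ι r)) k f S fun x i => ⟨a x i, hmem x i⟩ :=
    Realizes.of_comp (F := S.subtype) (fun ι r x => realize_formula_isQF_embedding _ (h1 ι r) x) ha
  have hSK : K.Mem S := K.mem_sub S hM
  refine ⟨S, inferInstance, _, hSK, le_antisymm ?_ ?_, ha'⟩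
  · have hfun : #(Σ i, L.Functions i) ≤ L.card := by
      rw [FirstOrder.Language.card_eq_card_functions_add_card_relations]
      simp [mk_sigma]
    have := FirstOrder.Language.Substructure.lift_card_closure_le (L := L) (s := s)
    simp only [lift_id] at this
    exact this.trans (max_le hlam (add_le_of_le hlam (mk_range_uncurry_le hlam a)
      (hfun.trans hL)))
  · exact hf.le_mk_of_realizes hlam ha' fun v => h3 S v hSK

/-- With two colours a single bit suffices, so `D` is a point and the condition on powers of `χ₁` is
trivial. -/
lemma RichOlive.le_univ {K : ModelClass L} (h : RichOlive K lam η k m) {χ₁ χ₂ : Cardinal.{u}}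
    (hQ : Qr₁ χ₂ χ₁ lam) : χ₂ ≤ K.univ lam χ₁ := by
  obtain ⟨ψ, h1, h2, h3⟩ := h
  refine le_univ_of_qrColours K ψ η k h1 h2 h3 (D := PUnit.{u + 1})
    (fun c _ => c.down) (fun c c' hc => ?_) ?_ ?_ hQ
  · exact ULift.ext _ _ (congrFun hc PUnit.unit)
  · rw [mk_punit]
    exact one_lt_aleph0.trans hQ.2.1
  · rw [mk_punit, power_one]

/-- A colour is a sequence of `d` bits, and the assumption `χ₁ = χ₁ ^ d` lets one ordinal below `χ₁`
code the `d` tuples attached to `δ`. -/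
lemma RichOlive.le_univ_of_qrTheta {K : ModelClass L} (h : RichOlive K lam η k m)
    {χ₁ χ₂ θ d : Cardinal.{u}} (hθ : θ = 2 ^ d) (hχ : χ₁ = χ₁ ^ d) (hd : d < lam)
    (hQ : QrTheta θ χ₂ χ₁ lam) : χ₂ ≤ K.univ lam χ₁ := by
  obtain ⟨ψ, h1, h2, h3⟩ := h
  have hcard : #θ.out = #(d.out → ULift.{u} (Fin 2)) := by simp [hθ]
  obtain ⟨H⟩ := Cardinal.eq.1 hcard
  refine le_univ_of_qrColours K ψ η k h1 h2 h3 (D := d.out)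
    (fun c i => (H c i).down) (fun c c' hc => H.injective (funext fun i => ?_)) ?_ ?_ hQ
  · exact ULift.ext _ _ (congrFun hc i)
  · rwa [mk_out]
  · rw [mk_out]
    exact hχ.symm

lemma RichOlive.not_hasUniversal {K : ModelClass L} (h : RichOlive K lam η k m)
    {κ : Cardinal.{u}} (hκ : κ.IsRegular) (hlam : lam.IsRegular) (hlt : Order.succ κ < lam)
    (hpow : lam < 2 ^ κ) : ¬ K.HasUniversal lam := by
  rintro ⟨M, _, hM, hMc, huniv⟩
  have h1 := h.le_univ (qr₁_of_regular hκ hlam hlt hpow)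
  have h2 : K.univ lam lam ≤ 1 := csInf_le' ⟨PUnit, fun _ => M, fun _ => inferInstance, mk_punit,
    fun _ => ⟨hM, hMc⟩, fun N _ hN hNc => ⟨PUnit.unit, huniv N hN hNc⟩⟩
  exact ((one_lt_aleph0.trans_le hlam.aleph0_le).trans hpow).not_ge (h1.trans h2)

end Classes

end Olive

/-! ### The theorem for all three kinds of classes -/

theorem theorem1p10 {L : FirstOrder.Language.{u, u}} {n : ℕ} (η : Fin n → Fin 2) (k : Fin 2 → ℕ)
    (hshape : Olive.IsShape η k) :
    -- no universal model
    (∀ T : L.Theory, T.IsComplete → (∃ m : ℕ, Olive.HasOlive T η k m) →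
      ∀ κ lam : Cardinal.{u}, κ.IsRegular → lam.IsRegular → Order.succ κ < lam →
        lam < 2 ^ κ → Order.succ (Order.succ κ) + L.card ≤ lam →
        ¬ (Olive.elemClass T).HasUniversal lam) ∧
    -- complete first order theories
    (∀ (T : L.Theory) (m : ℕ), T.IsComplete → Olive.HasOlive T η k m →
      ∀ lam χ₁ χ₂ : Cardinal.{u}, lam.IsRegular → L.card ≤ lam → Olive.Qr₁ χ₂ χ₁ lam →
        χ₂ ≤ (Olive.elemClass T).univ lam χ₁) ∧
    -- abstract elementary classes
    (∀ (K : Olive.ModelClass L) (m : ℕ), Olive.IsAEC K →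
      ∀ lam : Cardinal.{u}, lam.IsRegular → Olive.HasOliveAEC K lam η k m →
        (∀ κ : Cardinal.{u}, κ.IsRegular → Order.succ κ < lam → lam < 2 ^ κ →
          ¬ K.HasUniversal lam) ∧
        (∀ χ₁ χ₂ : Cardinal.{u}, Olive.Qr₁ χ₂ χ₁ lam → χ₂ ≤ K.univ lam χ₁)) ∧
    -- universal classes, ordered by being a substructure
    (∀ (K : Olive.UniversalClass L) (m : ℕ),
      ∀ lam : Cardinal.{u}, lam.IsRegular → L.card ≤ lam → Olive.HasOliveQF K lam η k m →
        (∀ κ : Cardinal.{u}, κ.IsRegular → Order.succ κ < lam → lam < 2 ^ κ →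
          ¬ K.toModelClass.HasUniversal lam) ∧
        (∀ χ₁ χ₂ : Cardinal.{u}, Olive.Qr₁ χ₂ χ₁ lam → χ₂ ≤ K.toModelClass.univ lam χ₁)) ∧
    -- the same with `Qr_{1,θ}`, where `θ = 2 ^ d`, `χ₁ ^ d = χ₁` and `d < lam`
    (∀ lam χ₁ χ₂ θ d : Cardinal.{u}, lam.IsRegular → θ = 2 ^ d → χ₁ = χ₁ ^ d → d < lam →
      Olive.QrTheta θ χ₂ χ₁ lam →
        (∀ (T : L.Theory) (m : ℕ), T.IsComplete → Olive.HasOlive T η k m → L.card ≤ lam →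
          χ₂ ≤ (Olive.elemClass T).univ lam χ₁) ∧
        (∀ (K : Olive.ModelClass L) (m : ℕ), Olive.IsAEC K → Olive.HasOliveAEC K lam η k m →
          χ₂ ≤ K.univ lam χ₁) ∧
        (∀ (K : Olive.UniversalClass L) (m : ℕ), L.card ≤ lam → Olive.HasOliveQF K lam η k m →
          χ₂ ≤ K.toModelClass.univ lam χ₁)) := by
  refine ⟨?_, ?_, ?_, ?_, ?_⟩
  · rintro T - ⟨m, h⟩ κ lam hκ hlam hlt hpow hL
    exact (h.richOlive hlam.aleph0_le (le_add_self.trans hL)).not_hasUniversal hκ hlam hlt hpow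
  · intro T m _ h lam χ₁ χ₂ hlam hL hQ
    exact (h.richOlive hlam.aleph0_le hL).le_univ hQ
  · intro K m _ lam hlam h
    exact ⟨fun κ hκ hlt hpow => h.richOlive.not_hasUniversal hκ hlam hlt hpow,
      fun χ₁ χ₂ hQ => h.richOlive.le_univ hQ⟩
  · intro K m lam hlam hL h
    have h' := h.richOlive hlam.aleph0_le hL
    exact ⟨fun κ hκ hlt hpow => h'.not_hasUniversal hκ hlam hlt hpow,
      fun χ₁ χ₂ hQ => h'.le_univ hQ⟩
  · intro lam χ₁ χ₂ θ d hlam hθ hχ hd hQ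
    exact ⟨fun T m _ h hL =>
        (h.richOlive hlam.aleph0_le hL).le_univ_of_qrTheta hθ hχ hd hQ,
      fun K m _ h => h.richOlive.le_univ_of_qrTheta hθ hχ hd hQ,
      fun K m hL h => (h.richOlive hlam.aleph0_le hL).le_univ_of_qrTheta hθ hχ hd hQ⟩
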